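/- Let $d\in\{2,3\}$, $k_d=\binom d2$, and let $0<m$, $M$ and $\beta>0$ be real numbers. There is a constant $C>0$, depending only on $d,m,M,\beta$, such that the following holds. **Domain and material.** Let $\Omega\subset\mathbb R^d$ be open (e.g. a bounded Lipschitz domain) with $\partial\Omega=\partial_e\Omega\sqcup\partial_n\Omega$. Let $\mu_\sigma,\mu_\sigma^c,\lambda_\sigma,\mu_\omega,\mu_\omega^c,\lambda_\omega$ be measurable functions (e.g. constants) with $\mu_\sigma,\mu^c_\sigma,\mu_\omega,\mu^c_\omega\in[m,M]$ and $\lambda_\sigma,\lambda_\omega\in[0,M]$ on $\Omega$. Let $$\mathcal A_\sigma\tau=\tfrac1{2\mu_\sigma}\Bigl(\operatorname{sym}\tau-\tfrac{\lambda_\sigma}{2\mu_\sigma+d\lambda_\sigma}(\operatorname{tr}\tau)I\Bigr)+\tfrac1{2\mu_\sigma^c}\operatorname{skw}\tau,$$ let $\mathcal A_\omega$ be given by the same formula with the $\omega$-parameters if $d=3$, and let $\mathcal A_\omega\tau=\tau/(2\mu_\omega)$ if $d=2$. Let $\operatorname{asym}\tau=\tau_{21}-\tau_{12}$ if $d=2$,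 and $\operatorname{asym}\tau=(\tau_{32}-\tau_{23},\tau_{13}-\tau_{31},\tau_{21}-\tau_{12})$ if $d=3$. Let $\ell\ge0$ be a continuous bounded function on $\Omega$. **Spaces.** Write $(\cdot,\cdot)_\Omega$ and $\|\cdot\|_\Omega$ for the $L^2(\Omega)$ inner product and norm; divergences of matrix fields are weak and taken row by row (couple stresses are written as $k_d\times d$ matrices, one row per component of the rotation). Let $$\Sigma=\{\sigma\in L^2(\Omega;\mathbb R^{d\times d}):\nabla\cdot\sigma\in L^2,\ \sigma n=0\text{ on }\partial_e\Omega\},\qquad W=\{\omega\in L^2(\Omega;\mathbb R^{k_d\times d}):\nabla\cdot(\ell\omega)\in L^2,\ \ell\omega n=0\text{ on }\partial_e\Omega\},$$ $U=L^2(\Omega;\mathbb R^d)$, $R=L^2(\Omega;\mathbb R^{k_d})$ and $Y=U\times R$ with $\|(u,r)\|_Y^2=\|u\|_\Omega^2+\|r\|_\Omega^2$. Here $\tau n=0$ on $\partial_e\Omega$ is meant weakly: $\int_\Omega\bigl(\sum_j\tau_{ij}\partial_j\varphi+(\nabla\cdot\tau)_i\,\varphi\bigr)=0$ for all rows $i$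 and all $\varphi\in C_c^\infty(\mathbb R^d)$ with $\operatorname{supp}\varphi\cap\partial\Omega\subseteq\partial_e\Omega$. Let $\Sigma_h\subseteq\Sigma$, $W_h\subseteq W$, $U_h\subseteq U$, $R_h\subseteq R$ be finite-dimensional subspaces, put $X_h=\Sigma_h\times W_h$ and $Y_h=U_h\times R_h$, let $\Pi_R$ be the $L^2$-orthogonal projection onto $R_h$, and let $$\|(\sigma,\omega)\|_{X_h}^2=\|\sigma\|_\Omega^2+\|\nabla\cdot\sigma\|_\Omega^2+\|\omega\|_\Omega^2+\|\Pi_R\nabla\cdot(\ell\omega)\|_\Omega^2,\qquad \|g\|_{X_h'}=\sup_{\eta\in X_h}\frac{\langle g,\eta\rangle}{\|\eta\|_{X_h}}.$$ **Hypotheses.** Assume $\nabla\cdot\Sigma_h\subseteq U_h$ and that $\Sigma_h\times U_h\times R_h$ is elasticity-stable with constant $\beta$, that is, $$\inf_{0\ne(u,r)\in U_h\times R_h}\ \sup_{\sigma\in\Sigma_h}\frac{(\nabla\cdot\sigma,u)_\Omega+(\operatorname{asym}\sigma,r)_\Omega}{(\|\sigma\|_\Omega^2+\|\nabla\cdot\sigma\|_\Omega^2)^{1/2}\,\|(u,r)\|_Y}\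 \ge\ \beta .$$ **Conclusion.** With $$\langle A(\sigma,\omega),(\sigma',\omega')\rangle=(\mathcal A_\sigma\sigma,\sigma')_\Omega+(\mathcal A_\omega\omega,\omega')_\Omega,\qquad \langle B(\sigma,\omega),(u,r)\rangle=-(\nabla\cdot\sigma,u)_\Omega+(\operatorname{asym}\sigma,r)_\Omega-(\nabla\cdot(\ell\omega),r)_\Omega,$$ for every $g\in X_h'$ and $f\in Y'$ the problem: find $(\eta_h,v_h)\in X_h\times Y_h$ such that $$\langle A\eta_h,\eta'\rangle-\langle B\eta',v_h\rangle+\langle B\eta_h,v'\rangle=\langle g,\eta'\rangle+\langle f,v'\rangle\qquad\forall(\eta',v')\in X_h\times Y_h$$ has a unique solution, and it satisfies $$\|\eta_h\|_{X_h}+\|v_h\|_Y\le C\bigl(\|g\|_{X_h'}+\|f\|_{Y'}\bigr).$$ In particular, for a family of discrete spaces that is elasticity-stable with $\beta$ independent of the mesh size $h$, the bound is uniform in $h$ and $\ell$. Nothing is required of $W_h$ beyond $W_h\subseteq W$. -/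

import Mathlib

noncomputable section

namespace Cosserat

open MeasureTheory

/-- Points and vectors of `ℝᵈ`, with the Euclidean inner product. -/
abbrev Vec (d : ℕ) := EuclideanSpace ℝ (Fin d)

/-- Real `p × d` matrices with the Frobenius inner product. -/
abbrev Mat (p d : ℕ) := EuclideanSpace ℝ (Fin p × Fin d)

/-- The number of components of a rotation: `1` in the plane, `3` in space. -/
abbrev rotDim (d : ℕ) : ℕ := d.choose 2

/-- Square-integrable fields on `Ω` with values in `F`. -/
abbrev L2 {d : ℕ} (Ω : Set (Vec d)) (F : Type) [NormedAddCommGroup F] : Type :=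
  Lp F 2 ((volume : Measure (Vec d)).restrict Ω)

/-- The pairing `(φ, ψ)_Ω = ∫_Ω φ ⋅ ψ`. -/
def pairing {d : ℕ} (Ω : Set (Vec d)) {F : Type} [NormedAddCommGroup F] [InnerProductSpace ℝ F]
    (φ ψ : Vec d → F) : ℝ :=
  ∫ x in Ω, inner ℝ (φ x) (ψ x)

/-! ### Algebra of matrices -/

/-- The asymmetry operator: `τ₂₁ - τ₁₂` for `d = 2` and
`(τ₃₂ - τ₂₃, τ₁₃ - τ₃₁, τ₂₁ - τ₁₂)` for `d = 3` (indices below start at `0`). -/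
def asym : (d : ℕ) → Mat d d → Vec (rotDim d)
  | 2, τ => WithLp.toLp 2 (fun _ => τ (1, 0) - τ (0, 1))
  | 3, τ => WithLp.toLp 2
      (![τ (2, 1) - τ (1, 2), τ (0, 2) - τ (2, 0), τ (1, 0) - τ (0, 1)] : Fin 3 → ℝ)
  | _, _ => 0

/-- The transpose of a square matrix. -/
def transp {d : ℕ} (τ : Mat d d) : Mat d d := WithLp.toLp 2 (fun ij => τ (ij.2, ij.1))

/-- The symmetric part of a square matrix. -/
def symPart {d : ℕ} (τ : Mat d d) : Mat d d := (1 / 2 : ℝ) • (τ + transp τ)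

/-- The skew part of a square matrix. -/
def skwPart {d : ℕ} (τ : Mat d d) : Mat d d := (1 / 2 : ℝ) • (τ - transp τ)

/-- The trace of a square matrix. -/
def trc {d : ℕ} (τ : Mat d d) : ℝ := ∑ i, τ (i, i)

/-- The identity matrix. -/
def idMat (d : ℕ) : Mat d d := WithLp.toLp 2 (fun ij => if ij.1 = ij.2 then 1 else 0)

/-- The isotropic Cosserat stiffness `2 μ sym τ + 2 μᶜ skw τ + λ (tr τ) I`. -/
def stiffness {d : ℕ} (mu muc lam : ℝ) (τ : Mat d d) : Mat d d :=
  (2 * mu) • symPart τ + (2 * muc) • skwPart τ + (lam * trc τ) • idMat d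

/-- The compliance, inverse to the stiffness:
`(1 / 2μ) (sym τ - λ / (2μ + dλ) (tr τ) I) + (1 / 2μᶜ) skw τ`. -/
def compliance {d : ℕ} (mu muc lam : ℝ) (τ : Mat d d) : Mat d d :=
  (1 / (2 * mu)) • (symPart τ - (lam / (2 * mu + d * lam) * trc τ) • idMat d)
    + (1 / (2 * muc)) • skwPart τ

/-- The couple-stress stiffness: isotropic Cosserat for `d = 3`, and `2 μ τ` for `d = 2`. -/
def coupleStiffness : (d : ℕ) → (mu muc lam : ℝ) → Mat (rotDim d) d → Mat (rotDim d) d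
  | 3, mu, muc, lam, τ => (stiffness (d := 3) mu muc lam τ : Mat 3 3)
  | _, mu, _, _, τ => (2 * mu) • τ

/-- The couple-stress compliance, inverse to the couple-stress stiffness. -/
def coupleCompliance : (d : ℕ) → (mu muc lam : ℝ) → Mat (rotDim d) d → Mat (rotDim d) d
  | 3, mu, muc, lam, τ => (compliance (d := 3) mu muc lam τ : Mat 3 3)
  | _, mu, _, _, τ => (1 / (2 * mu)) • τ

theorem compliance_stiffness {d : ℕ} {mu muc lam : ℝ} (hmu : 0 < mu) (hmuc : 0 < muc)
    (hlam : 0 ≤ lam) (τ : Mat d d) :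
    compliance mu muc lam (stiffness mu muc lam τ) = τ := by
  have h1 : (2 * mu + d * lam) ≠ 0 := by positivity
  have htr : trc (stiffness mu muc lam τ) = (2 * mu + d * lam) * trc τ := by
    simp only [trc, stiffness, symPart, skwPart, transp, idMat, PiLp.add_apply, PiLp.smul_apply,
      PiLp.sub_apply, smul_eq_mul, if_true, mul_one, Finset.sum_add_distrib, sub_self, mul_zero,
      Finset.sum_const, Finset.card_univ, Fintype.card_fin, nsmul_eq_mul, add_zero,
      ← Finset.mul_sum]
    ring
  ext ⟨i, j⟩
  have hij : (if i = j then (1 : ℝ) else 0) = (if j = i then (1 : ℝ) else 0) := by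
    simp only [eq_comm]
  simp only [compliance, htr]
  simp only [stiffness, symPart, skwPart, transp, idMat, PiLp.add_apply, PiLp.smul_apply,
    PiLp.sub_apply, smul_eq_mul, hij]
  field_simp
  ring

theorem coupleCompliance_coupleStiffness {d : ℕ} (hd : d = 2 ∨ d = 3) {mu muc lam : ℝ}
    (hmu : 0 < mu) (hmuc : 0 < muc) (hlam : 0 ≤ lam) (τ : Mat (rotDim d) d) :
    coupleCompliance d mu muc lam (coupleStiffness d mu muc lam τ) = τ := by
  rcases hd with rfl | rfl
  · change (1 / (2 * mu)) • ((2 * mu) • τ) = τ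
    rw [smul_smul, one_div, inv_mul_cancel₀ (by positivity), one_smul]
  · exact compliance_stiffness (d := 3) hmu hmuc hlam τ

/-- The material parameters of stress and couple stress, possibly varying in space. -/
structure Material (d : ℕ) where
  /-- shear modulus of the stress -/
  muS : Vec d → ℝ
  /-- Cosserat couple modulus of the stress -/
  mucS : Vec d → ℝ
  /-- first Lamé parameter of the stress -/
  lamS : Vec d → ℝ
  /-- shear modulus of the couple stress -/
  muW : Vec d → ℝ
  /-- Cosserat couple modulus of the couple stress -/
  mucW : Vec d → ℝ
  /-- first Lamé parameter of the couple stress -/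
  lamW : Vec d → ℝ

/-- The parameters are measurable, `μ`-type moduli lie in `[m, M]`, and `λ`-type moduli in
`[0, M]`, on `Ω`. Positive constants `μ` and non-negative constants `λ` are the basic example. -/
structure Material.Admissible {d : ℕ} (P : Material d) (Ω : Set (Vec d)) (m M : ℝ) : Prop where
  measurable : Measurable P.muS ∧ Measurable P.mucS ∧ Measurable P.lamS ∧
    Measurable P.muW ∧ Measurable P.mucW ∧ Measurable P.lamW
  muS_mem : ∀ x ∈ Ω, P.muS x ∈ Set.Icc m M
  mucS_mem : ∀ x ∈ Ω, P.mucS x ∈ Set.Icc m M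
  lamS_mem : ∀ x ∈ Ω, P.lamS x ∈ Set.Icc 0 M
  muW_mem : ∀ x ∈ Ω, P.muW x ∈ Set.Icc m M
  mucW_mem : ∀ x ∈ Ω, P.mucW x ∈ Set.Icc m M
  lamW_mem : ∀ x ∈ Ω, P.lamW x ∈ Set.Icc 0 M

/-! ### Weak row-wise divergence, normal traces, and the continuous spaces -/

/-- The `j`-th partial derivative. -/
def partialDeriv {d : ℕ} (j : Fin d) (φ : Vec d → ℝ) (x : Vec d) : ℝ :=
  fderiv ℝ φ x (EuclideanSpace.single j 1)

/-- `g` is the distributional row-wise divergence of `τ` on `Ω`: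
`∫_Ω ∑ⱼ τᵢⱼ ∂ⱼφ = - ∫_Ω gᵢ φ` for every test function `φ ∈ C_c^∞(Ω)` and every row `i`. -/
def IsWeakDiv {p d : ℕ} (Ω : Set (Vec d)) (τ : Vec d → Mat p d) (g : L2 Ω (Vec p)) : Prop :=
  ∀ φ : Vec d → ℝ, ContDiff ℝ (⊤ : ℕ∞) φ → HasCompactSupport φ → tsupport φ ⊆ Ω →
    ∀ i : Fin p,
      ∫ x in Ω, ∑ j, τ x (i, j) * partialDeriv j φ x = - ∫ x in Ω, g x i * φ x

theorem IsWeakDiv.unique {p d : ℕ} {Ω : Set (Vec d)} (hΩ : IsOpen Ω) {τ : Vec d → Mat p d}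
    {g g' : L2 Ω (Vec p)} (h : IsWeakDiv Ω τ g) (h' : IsWeakDiv Ω τ g') : g = g' := by
  have key : ∀ i : Fin p, ∀ᵐ x : Vec d, x ∈ Ω → (g x i - g' x i) = 0 := by
    intro i
    have hcomp : ∀ k : L2 Ω (Vec p),
        MemLp (fun x => k x i) 2 ((volume : Measure (Vec d)).restrict Ω) := fun k =>
      (EuclideanSpace.proj (𝕜 := ℝ) i).comp_memLp' (Lp.memLp k)
    have hloc : ∀ k : L2 Ω (Vec p),
        LocallyIntegrable (fun x => k x i) ((volume : Measure (Vec d)).restrict Ω) := fun k =>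
      (hcomp k).locallyIntegrable (by norm_num)
    refine hΩ.ae_eq_zero_of_integral_contDiff_smul_eq_zero
      (f := fun x => g x i - g' x i)
      (locallyIntegrableOn_of_locallyIntegrable_restrict ((hloc g).sub (hloc g'))) ?_
    intro φ hφ hc hs
    have h1 := h φ hφ hc hs i
    have h2 := h' φ hφ hc hs i
    rw [h1] at h2
    have hint : ∀ k : L2 Ω (Vec p), Integrable (fun x => φ x • k x i)
        ((volume : Measure (Vec d)).restrict Ω) := fun k =>
      (hloc k).integrable_smul_left_of_hasCompactSupport hφ.continuous hc
    rw [← setIntegral_eq_integral_of_forall_compl_eq_zero (s := Ω)]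
    · simp only [smul_sub]
      rw [integral_sub (hint g) (hint g')]
      simp only [smul_eq_mul, mul_comm (φ _)]
      linarith
    · intro x hx
      have : φ x = 0 := by
        by_contra hne
        exact hx (hs (subset_tsupport φ hne))
      simp [this]
  have hall : ∀ᵐ x ∂((volume : Measure (Vec d)).restrict Ω), ∀ i : Fin p, g x i - g' x i = 0 :=
    ae_all_iff.2 fun i => (ae_restrict_iff' hΩ.measurableSet).2 (key i)
  refine Lp.ext ?_
  filter_upwards [hall] with x hx
  ext i
  exact sub_eq_zero.1 (hx i)

open Classical in
/-- The divergence of `τ` as an element of `L²`; it is only used for fields that have one. -/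
def weakDiv {p d : ℕ} (Ω : Set (Vec d)) (τ : Vec d → Mat p d) : L2 Ω (Vec p) :=
  if h : ∃ g : L2 Ω (Vec p), IsWeakDiv Ω τ g then h.choose else 0

theorem IsWeakDiv.weakDiv_eq {p d : ℕ} {Ω : Set (Vec d)} (hΩ : IsOpen Ω) {τ : Vec d → Mat p d}
    {g : L2 Ω (Vec p)} (h : IsWeakDiv Ω τ g) : weakDiv Ω τ = g := by
  have hex : ∃ g : L2 Ω (Vec p), IsWeakDiv Ω τ g := ⟨g, h⟩
  rw [weakDiv, dif_pos hex]
  exact hex.choose_spec.unique hΩ h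

/-- The field `τ` with divergence `g` has vanishing normal trace on the part `Γe` of the boundary,
in the weak sense of Green's formula: `∫_Ω (∑ⱼ τᵢⱼ ∂ⱼφ + gᵢ φ) = 0` for every row `i` and every
smooth compactly supported `φ` on `ℝᵈ` whose support meets `∂Ω` only inside `Γe`. -/
def NormalTraceZero {p d : ℕ} (Ω Γe : Set (Vec d)) (τ : Vec d → Mat p d) (g : L2 Ω (Vec p)) :
    Prop :=
  ∀ φ : Vec d → ℝ, ContDiff ℝ (⊤ : ℕ∞) φ → HasCompactSupport φ →
    tsupport φ ∩ frontier Ω ⊆ Γe →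
    ∀ i : Fin p, ∫ x in Ω, ((∑ j, τ x (i, j) * partialDeriv j φ x) + g x i * φ x) = 0

/-- The stress space `Σ`: fields in `L²` with divergence in `L²` and `σ n = 0` on `Γe`. -/
def stressSpace {d : ℕ} (Ω Γe : Set (Vec d)) : Set (L2 Ω (Mat d d)) :=
  {σ | ∃ g : L2 Ω (Vec d), IsWeakDiv Ω σ g ∧ NormalTraceZero Ω Γe σ g}

/-- The field `ℓ ω`. -/
def scaled {p d : ℕ} {Ω : Set (Vec d)} (l : Vec d → ℝ) (ω : L2 Ω (Mat p d)) : Vec d → Mat p d :=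
  fun x => l x • ω x

/-- The couple-stress space `W`: fields `ω` in `L²` such that `ℓ ω` has divergence in `L²` and
`(ℓ ω) n = 0` on `Γe`. The rows of `ω` correspond to the components of the rotation. -/
def coupleSpace {d : ℕ} (Ω Γe : Set (Vec d)) (l : Vec d → ℝ) : Set (L2 Ω (Mat (rotDim d) d)) :=
  {ω | ∃ g : L2 Ω (Vec (rotDim d)),
    IsWeakDiv Ω (scaled l ω) g ∧ NormalTraceZero Ω Γe (scaled l ω) g}

/-! ### Bilinear forms, norms and the discrete problem -/

/-- The displacement-rotation space `Y = U × R`, with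
`‖(u, r)‖_Y² = ‖u‖² + ‖r‖²`. -/
abbrev YSpace {d : ℕ} (Ω : Set (Vec d)) : Type := WithLp 2 (L2 Ω (Vec d) × L2 Ω (Vec (rotDim d)))

/-- `⟨A (σ, ω), (σ', ω')⟩ = (𝒜_σ σ, σ')_Ω + (𝒜_ω ω, ω')_Ω`. -/
def formA {d : ℕ} (Ω : Set (Vec d)) (P : Material d) (σ : L2 Ω (Mat d d))
    (ω : L2 Ω (Mat (rotDim d) d)) (σ' : L2 Ω (Mat d d)) (ω' : L2 Ω (Mat (rotDim d) d)) : ℝ :=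
  pairing Ω (fun x => compliance (P.muS x) (P.mucS x) (P.lamS x) (σ x)) σ'
    + pairing Ω (fun x => coupleCompliance d (P.muW x) (P.mucW x) (P.lamW x) (ω x)) ω'

/-- `⟨B (σ, ω), (u, r)⟩ = -(div σ, u)_Ω + (asym σ, r)_Ω - (div (ℓ ω), r)_Ω`. -/
def formB {d : ℕ} (Ω : Set (Vec d)) (l : Vec d → ℝ) (σ : L2 Ω (Mat d d))
    (ω : L2 Ω (Mat (rotDim d) d)) (u : L2 Ω (Vec d)) (r : L2 Ω (Vec (rotDim d))) : ℝ :=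
  - pairing Ω (weakDiv Ω σ) u + pairing Ω (fun x => asym d (σ x)) r
    - pairing Ω (weakDiv Ω (scaled l ω)) r

/-- `‖(σ, 0)‖_X`, the `H(div)` norm of the stress. -/
def stressNorm {d : ℕ} (Ω : Set (Vec d)) (σ : L2 Ω (Mat d d)) : ℝ :=
  Real.sqrt (‖σ‖ ^ 2 + ‖weakDiv Ω σ‖ ^ 2)

/-- The triplet `Σ_h × U_h × R_h` is elasticity-stable with constant `β`:
the inf-sup quotient of elasticity with weakly imposed symmetry is at least `β`. -/
def ElasticityStable {d : ℕ} (Ω : Set (Vec d)) (β : ℝ) (Sh : Submodule ℝ (L2 Ω (Mat d d)))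
    (Uh : Submodule ℝ (L2 Ω (Vec d))) (Rh : Submodule ℝ (L2 Ω (Vec (rotDim d)))) : Prop :=
  ∀ u ∈ Uh, ∀ r ∈ Rh, (u, r) ≠ 0 →
    β ≤ ⨆ σ : Sh,
      (pairing Ω (weakDiv Ω (σ : L2 Ω (Mat d d))) u
          + pairing Ω (fun x => asym d ((σ : L2 Ω (Mat d d)) x)) r)
        / (stressNorm Ω (σ : L2 Ω (Mat d d)) * ‖(WithLp.toLp 2 (u, r) : YSpace Ω)‖)

/-- The discrete norm
`‖(σ, ω)‖² = ‖σ‖² + ‖div σ‖² + ‖ω‖² + ‖Π_R div (ℓ ω)‖²`,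
where `Π_R` is the `L²` projection onto `R_h`. -/
def normXh {d : ℕ} (Ω : Set (Vec d)) (l : Vec d → ℝ)
    (Rh : Submodule ℝ (L2 Ω (Vec (rotDim d)))) [FiniteDimensional ℝ Rh]
    (σ : L2 Ω (Mat d d)) (ω : L2 Ω (Mat (rotDim d) d)) : ℝ :=
  Real.sqrt (‖σ‖ ^ 2 + ‖weakDiv Ω σ‖ ^ 2 + ‖ω‖ ^ 2
    + ‖Rh.starProjection (weakDiv Ω (scaled l ω))‖ ^ 2)

/-- The dual norm `‖g‖_{X_h'} = sup_{η ∈ X_h} ⟨g, η⟩ / ‖η‖_{X_h}` on `X_h = Σ_h × W_h`. -/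
def dualNormXh {d : ℕ} (Ω : Set (Vec d)) (l : Vec d → ℝ)
    (Rh : Submodule ℝ (L2 Ω (Vec (rotDim d)))) [FiniteDimensional ℝ Rh]
    {Sh : Submodule ℝ (L2 Ω (Mat d d))} {Wh : Submodule ℝ (L2 Ω (Mat (rotDim d) d))}
    (g : (Sh × Wh) →ₗ[ℝ] ℝ) : ℝ :=
  ⨆ η : Sh × Wh, g η / normXh Ω l Rh (η.1 : L2 Ω (Mat d d)) (η.2 : L2 Ω (Mat (rotDim d) d))

/-- `((σ, ω), (u, r)) ∈ X_h × Y_h` solves the mixed finite element problem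
`⟨A η, η'⟩ - ⟨B η', v⟩ + ⟨B η, v'⟩ = ⟨g, η'⟩ + ⟨f, v'⟩` for all `(η', v') ∈ X_h × Y_h`. -/
def IsSolution {d : ℕ} (Ω : Set (Vec d)) (P : Material d) (l : Vec d → ℝ)
    {Sh : Submodule ℝ (L2 Ω (Mat d d))} {Wh : Submodule ℝ (L2 Ω (Mat (rotDim d) d))}
    {Uh : Submodule ℝ (L2 Ω (Vec d))} {Rh : Submodule ℝ (L2 Ω (Vec (rotDim d)))}
    (g : (Sh × Wh) →ₗ[ℝ] ℝ) (f : StrongDual ℝ (YSpace Ω)) (z : (Sh × Wh) × (Uh × Rh)) : Prop :=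
  ∀ (σ' : Sh) (ω' : Wh) (u' : Uh) (r' : Rh),
    formA Ω P z.1.1 z.1.2 σ' ω' - formB Ω l σ' ω' z.2.1 z.2.2 + formB Ω l z.1.1 z.1.2 u' r'
      = g (σ', ω') + f (WithLp.toLp 2 ((u' : L2 Ω (Vec d)), (r' : L2 Ω (Vec (rotDim d)))))

end Cosserat

end

/-! The couple stress needs no inf-sup condition of its own. Write `D`, `J`, `E` for the maps `σ ↦
div σ`, `σ ↦ Π_R asym σ` and `ω ↦ Π_R div (ℓ ω)`, with values in the discrete spaces. Multipliers
are controlled by stresses alone: test pairs `(σ', 0)` reduce `B` to the elasticity form, up to the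
sign of `u`, so elasticity stability bounds `(u, r)` by `‖σ‖` and the data.

The compliance is coercive only in `L²`, but the other two terms of the discrete norm come from the
constraint equation. The test function `(D σ, 0)` is admissible because `div Σ_h ⊆ U_h`, and gives
`‖D σ‖ ≤ ‖f‖`. The test function `(0, E ω)` is admissible because of the projection in the norm, and
gives `‖E ω‖ ≤ 2 ‖σ‖ + ‖f‖`. Testing with the solution itself cancels the `B` terms and leaves a
quadratic inequality for `‖σ‖ + ‖ω‖`, which is absorbed. No bound on `E` is used, so neither `ℓ` nor
`W_h` enters the constant.

`saddle_estimate` carries this argument. Uniqueness is the case of zero data, and existence follows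
since the discrete system is square (`saddle_wellPosed`). What remains is the pointwise bounds
`norm_compliance_le`, `inner_compliance_ge` and `norm_asym_le`, their transfer to `L²` by
`exists_pointwiseOp`, the linearity of the weak divergence (`exists_weakDivLin`), and the dual norm.
-/

namespace Cosserat

open MeasureTheory

/-! ### Scalar inequalities -/

/-- The elementary absorption argument behind the energy estimate. -/
theorem le_of_sq_le_absorb {e N Q : ℝ} (hN : 0 ≤ N) (hQ : 0 ≤ Q)
    (h : e ^ 2 ≤ Q * (N * e + N ^ 2)) : e ≤ (Q + 1) * N := by
  by_contra hlt
  push Not at hlt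
  have he : 0 < e := lt_of_le_of_lt (by positivity) hlt
  have h1 : N * N ≤ N * e := mul_le_mul_of_nonneg_left (by nlinarith [mul_nonneg hQ hN]) hN
  have h2 : (Q + 1) * N * e < e * e := mul_lt_mul_of_pos_right hlt he
  nlinarith [mul_nonneg hQ hN, mul_le_mul_of_nonneg_left hlt.le (mul_nonneg hQ hN)]

/-- The stability constant of the abstract saddle point problem. -/
noncomputable def saddleConst (c K β : ℝ) : ℝ :=
  (3 + 2 / β * K) * (2 / c * (3 + 2 / β * K + 2 / β) + 1) + 2 + 2 / β

theorem saddleConst_pos {c K β : ℝ} (hc : 0 < c) (hK : 0 ≤ K) (hβ : 0 < β) :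
    0 < saddleConst c K β := by
  unfold saddleConst; positivity

theorem sqrt_sum_sq_le {a b c d : ℝ} (ha : 0 ≤ a) (hb : 0 ≤ b) (hc : 0 ≤ c) (hd : 0 ≤ d) :
    Real.sqrt (a ^ 2 + b ^ 2 + c ^ 2 + d ^ 2) ≤ a + b + c + d := by
  rw [Real.sqrt_le_left (by positivity)]
  nlinarith [mul_nonneg ha hb, mul_nonneg ha hc, mul_nonneg ha hd, mul_nonneg hb hc,
    mul_nonneg hb hd, mul_nonneg hc hd]

/-- Here `s, w, p, q` stand for `‖σ‖, ‖ω‖, ‖D σ‖, ‖E ω‖`, `X` and `v` for the norms of the two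
halves of the solution, `G` and `F` for those of the data. Both `X` and `v` are at most linear in `e
= s + w` and `N = G + F`, so the energy inequality becomes `e² ≤ Q (N e + N²)`, and absorption
bounds `e` by `N`. -/
theorem saddle_arith {c K β s w p q v X G F : ℝ} (hc : 0 < c) (hK : 0 ≤ K) (hβ : 0 < β)
    (hs : 0 ≤ s) (hw : 0 ≤ w) (hG : 0 ≤ G) (hF : 0 ≤ F)
    (hX : X ≤ s + p + w + q) (hp : p ≤ F) (hq : q ≤ 2 * s + F)
    (hv : v ≤ 2 / β * (K * s + G)) (hen : c * (s ^ 2 + w ^ 2) ≤ G * X + F * v) :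
    X + v ≤ saddleConst c K β * (G + F) := by
  set b := 2 / β with hb
  have hb0 : 0 ≤ b := by positivity
  set e := s + w with he
  set N := G + F with hN
  have he0 : 0 ≤ e := by positivity
  have hN0 : 0 ≤ N := by positivity
  have hX' : X ≤ 3 * e + 2 * N := by linarith
  have hv' : v ≤ b * K * e + b * N := by
    have : b * (K * s + G) ≤ b * (K * e + N) :=
      mul_le_mul_of_nonneg_left (add_le_add (mul_le_mul_of_nonneg_left (by linarith) hK)
        (by linarith)) hb0
    linarith
  have h1 : G * X ≤ N * (3 * e + 2 * N) :=
    (mul_le_mul_of_nonneg_left hX' hG).trans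
      (mul_le_mul_of_nonneg_right (by linarith) (by positivity))
  have h2 : F * v ≤ N * (b * K * e + b * N) :=
    (mul_le_mul_of_nonneg_left hv' hF).trans
      (mul_le_mul_of_nonneg_right (by linarith) (by positivity))
  -- The factor `2` comes from `(s + w)² ≤ 2 (s² + w²)`; the coefficients `3 + b K` of `N e` and `2
  -- + b` of `N²` are both enlarged to `3 + b K + b`.
  have h3 : c * e ^ 2 ≤ 2 * ((3 + b * K + b) * (N * e + N ^ 2)) := by
    have h4 : e ^ 2 ≤ 2 * (s ^ 2 + w ^ 2) := by nlinarith [sq_nonneg (s - w)]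
    have h5 : c * e ^ 2 ≤ c * (2 * (s ^ 2 + w ^ 2)) := mul_le_mul_of_nonneg_left h4 hc.le
    have h6 : 0 ≤ b * (N * e) := by positivity
    have h7 : 0 ≤ b * K * N ^ 2 := by positivity
    nlinarith [sq_nonneg N]
  have h4 : e ^ 2 ≤ 2 / c * (3 + b * K + b) * (N * e + N ^ 2) := by
    rw [show 2 / c * (3 + b * K + b) * (N * e + N ^ 2)
      = 2 * ((3 + b * K + b) * (N * e + N ^ 2)) / c by ring, le_div_iff₀ hc]
    linarith
  have h5 := le_of_sq_le_absorb hN0 (by positivity) h4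
  have h6 := mul_le_mul_of_nonneg_left h5 (show 0 ≤ 3 + b * K by positivity)
  unfold saddleConst
  rw [← hb]
  linarith

/-! ### The abstract finite-dimensional saddle point problem -/

section Saddle

variable {S W U R : Type*}
  [NormedAddCommGroup S] [NormedSpace ℝ S] [NormedAddCommGroup W] [NormedSpace ℝ W]
  [NormedAddCommGroup U] [InnerProductSpace ℝ U] [NormedAddCommGroup R] [InnerProductSpace ℝ R]

/-- The constraint form `-⟨D σ, u⟩ + ⟨J σ, r⟩ - ⟨E ω, r⟩`. -/
noncomputable def saddleB (D : S →ₗ[ℝ] U) (J : S →ₗ[ℝ] R) (E : W →ₗ[ℝ] R) :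
    (S × W) →ₗ[ℝ] (U × R) →ₗ[ℝ] ℝ :=
  LinearMap.mk₂ ℝ (fun x y => -inner ℝ (D x.1) y.1 + inner ℝ (J x.1) y.2 - inner ℝ (E x.2) y.2)
    (by intro x x' y; simp only [Prod.fst_add, Prod.snd_add, map_add, inner_add_left]; ring)
    (by intro c x y
        simp only [Prod.smul_fst, Prod.smul_snd, map_smul, real_inner_smul_left, smul_eq_mul]; ring)
    (by intro x y y'; simp only [Prod.fst_add, Prod.snd_add, inner_add_right]; ring)
    (by intro c x y
        simp only [Prod.smul_fst, Prod.smul_snd, real_inner_smul_right, smul_eq_mul]; ring)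

theorem saddleB_apply (D : S →ₗ[ℝ] U) (J : S →ₗ[ℝ] R) (E : W →ₗ[ℝ] R) (x : S × W) (y : U × R) :
    saddleB D J E x y = -inner ℝ (D x.1) y.1 + inner ℝ (J x.1) y.2 - inner ℝ (E x.2) y.2 := rfl

/-- The operator of the saddle point problem. -/
noncomputable def saddleOp (a : (S × W) →ₗ[ℝ] (S × W) →ₗ[ℝ] ℝ)
    (b : (S × W) →ₗ[ℝ] (U × R) →ₗ[ℝ] ℝ) :
    ((S × W) × (U × R)) →ₗ[ℝ] Module.Dual ℝ ((S × W) × (U × R)) :=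
  LinearMap.mk₂ ℝ (fun z y => a z.1 y.1 - b y.1 z.2 + b z.1 y.2)
    (by intro x x' y; simp only [Prod.fst_add, Prod.snd_add, map_add, LinearMap.add_apply]; ring)
    (by intro c x y
        simp only [Prod.smul_fst, Prod.smul_snd, map_smul, LinearMap.smul_apply, smul_eq_mul]; ring)
    (by intro x y y'; simp only [Prod.fst_add, Prod.snd_add, map_add, LinearMap.add_apply]; ring)
    (by intro c x y
        simp only [Prod.smul_fst, Prod.smul_snd, map_smul, LinearMap.smul_apply, smul_eq_mul]; ring)

theorem saddleOp_apply (a : (S × W) →ₗ[ℝ] (S × W) →ₗ[ℝ] ℝ)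
    (b : (S × W) →ₗ[ℝ] (U × R) →ₗ[ℝ] ℝ) (z y : (S × W) × (U × R)) :
    saddleOp a b z y = a z.1 y.1 - b y.1 z.2 + b z.1 y.2 := rfl

/-- The discrete graph norm on `S × W`. -/
noncomputable def graphNorm (D : S →ₗ[ℝ] U) (E : W →ₗ[ℝ] R) (x : S × W) : ℝ :=
  Real.sqrt (‖x.1‖ ^ 2 + ‖D x.1‖ ^ 2 + ‖x.2‖ ^ 2 + ‖E x.2‖ ^ 2)

/-- The Hilbert norm on `U × R`. -/
noncomputable def pairNorm (y : U × R) : ℝ := Real.sqrt (‖y.1‖ ^ 2 + ‖y.2‖ ^ 2)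

theorem le_of_sq_le_mul {p F : ℝ} (hp : 0 ≤ p) (hF : 0 ≤ F) (h : p ^ 2 ≤ F * p) : p ≤ F := by
  rcases hp.eq_or_lt with h0 | h0
  · rwa [← h0]
  · rw [sq] at h; exact le_of_mul_le_mul_right h h0

/-- Four test functions suffice: `D σ`, `E ω`, the solution itself, and a stress from the inf-sup
condition. Coercivity is required only in the weaker norm without `D` and `E`, since the first two
tests recover these terms, and boundedness of `a` only against pairs `(σ', 0)`. -/
theorem saddle_estimate (a : (S × W) →ₗ[ℝ] (S × W) →ₗ[ℝ] ℝ) (D : S →ₗ[ℝ] U) (J : S →ₗ[ℝ] R)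
    (E : W →ₗ[ℝ] R) {c K β : ℝ} (hc : 0 < c) (hK : 0 ≤ K) (hβ : 0 < β)
    (hcoer : ∀ x, c * (‖x.1‖ ^ 2 + ‖x.2‖ ^ 2) ≤ a x x)
    (hbdd : ∀ (x : S × W) (σ : S), a x (σ, 0) ≤ K * ‖x.1‖ * ‖σ‖)
    (hJ : ∀ σ, ‖J σ‖ ≤ 2 * ‖σ‖)
    (hinf : ∀ y : U × R, y ≠ 0 → ∃ σ : S, 0 < graphNorm D E (σ, 0) ∧
      β / 2 * (graphNorm D E (σ, 0) * pairNorm y) ≤ inner ℝ (D σ) y.1 + inner ℝ (J σ) y.2)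
    {G F : ℝ} (hG : 0 ≤ G) (hF : 0 ≤ F) (g : (S × W) → ℝ) (f : (U × R) → ℝ)
    (hg : ∀ x, |g x| ≤ G * graphNorm D E x) (hf : ∀ y, |f y| ≤ F * pairNorm y)
    (z : (S × W) × (U × R))
    (hz : ∀ y, saddleOp a (saddleB D J E) z y = g y.1 + f y.2) :
    graphNorm D E z.1 + pairNorm z.2 ≤ saddleConst c K β * (G + F) := by
  obtain ⟨⟨σ, ω⟩, ⟨u, r⟩⟩ := z
  -- No linearity of `g` and `f` is assumed; their vanishing at zero comes from the bounds.
  have hg0 : g 0 = 0 := by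
    have := hg 0
    simpa [graphNorm] using this
  have hf0 : f 0 = 0 := by
    have := hf 0
    simpa [pairNorm] using this
  have hp : ‖D σ‖ ≤ F := by
    have h1 := hz (0, (D σ, 0))
    have h2 := hf (D σ, 0)
    simp only [saddleOp_apply, saddleB_apply, hg0, map_zero, inner_zero_right,
      real_inner_self_eq_norm_sq, LinearMap.zero_apply] at h1
    simp only [pairNorm, norm_zero, ne_eq, OfNat.ofNat_ne_zero, not_false_eq_true, zero_pow,
      add_zero, Real.sqrt_sq (norm_nonneg _)] at h2
    exact le_of_sq_le_mul (norm_nonneg _) hF (by linarith [neg_abs_le (f (D σ, 0))])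
  have hq : ‖E ω‖ ≤ 2 * ‖σ‖ + F := by
    have h1 := hz (0, (0, E ω))
    have h2 := hf (0, E ω)
    simp only [saddleOp_apply, saddleB_apply, hg0, map_zero, inner_zero_right,
      real_inner_self_eq_norm_sq, LinearMap.zero_apply] at h1
    simp only [pairNorm, norm_zero, ne_eq, OfNat.ofNat_ne_zero, not_false_eq_true, zero_pow,
      zero_add, Real.sqrt_sq (norm_nonneg _)] at h2
    have h3 := real_inner_le_norm (J σ) (E ω)
    have h4 := mul_le_mul_of_nonneg_right (hJ σ) (norm_nonneg (E ω))
    refine le_of_sq_le_mul (norm_nonneg _) (by positivity) ?_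
    linarith [neg_abs_le (f (0, E ω))]
  have hX : graphNorm D E (σ, ω) ≤ ‖σ‖ + ‖D σ‖ + ‖ω‖ + ‖E ω‖ :=
    sqrt_sum_sq_le (norm_nonneg _) (norm_nonneg _) (norm_nonneg _) (norm_nonneg _)
  have hen : c * (‖σ‖ ^ 2 + ‖ω‖ ^ 2) ≤ G * graphNorm D E (σ, ω) + F * pairNorm (u, r) := by
    -- On the diagonal the two constraint terms cancel, leaving only the energy.
    have h1 := hz ((σ, ω), (u, r))
    rw [saddleOp_apply] at h1
    have h2 := hcoer (σ, ω)
    have h3 := hg (σ, ω)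
    have h4 := hf (u, r)
    simp only at h1 h2
    linarith [le_abs_self (g (σ, ω)), le_abs_self (f (u, r))]
  have hv : pairNorm (u, r) ≤ 2 / β * (K * ‖σ‖ + G) := by
    -- The inf-sup condition is applied at `(-u, r)`, because the divergence has a minus sign in the
    -- constraint form and a plus sign in the inf-sup quotient. The pair norm does not see this
    -- sign.
    by_cases h0 : ((-u, r) : U × R) = 0
    · have : u = 0 ∧ r = 0 := by simpa [Prod.ext_iff] using h0
      rw [this.1, this.2]
      simp only [pairNorm, norm_zero]
      norm_num
      positivity
    · obtain ⟨σ', hpos, hσ'⟩ := hinf (-u, r) h0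
      have h1 := hz ((σ', 0), 0)
      simp only [saddleOp_apply, saddleB_apply, hf0, map_zero, inner_zero_left] at h1
      have h2 := hbdd (σ, ω) σ'
      have h3 := hg (σ', 0)
      have h4 : ‖σ'‖ ≤ graphNorm D E (σ', 0) := Real.le_sqrt_of_sq_le (by
        nlinarith [sq_nonneg ‖D σ'‖, sq_nonneg ‖(0 : W)‖, sq_nonneg ‖E 0‖])
      have h5 : K * ‖σ‖ * ‖σ'‖ ≤ K * ‖σ‖ * graphNorm D E (σ', 0) :=
        mul_le_mul_of_nonneg_left h4 (by positivity)
      have h6 : pairNorm (-u, r) = pairNorm (u, r) := by simp [pairNorm]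
      rw [h6, inner_neg_right] at hσ'
      have h7 : (β / 2 * pairNorm (u, r)) * graphNorm D E (σ', 0)
          ≤ (K * ‖σ‖ + G) * graphNorm D E (σ', 0) := by
        simp only at h2
        linarith [neg_abs_le (g (σ', 0))]
      have h8 := le_of_mul_le_mul_right h7 hpos
      calc pairNorm (u, r) = 2 / β * (β / 2 * pairNorm (u, r)) := by field_simp
        _ ≤ _ := mul_le_mul_of_nonneg_left h8 (by positivity)
  exact saddle_arith hc hK hβ (norm_nonneg _) (norm_nonneg _) hG hF hX hp hq hv hen

theorem eq_zero_of_graphNorm_add_pairNorm {D : S →ₗ[ℝ] U} {E : W →ₗ[ℝ] R}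
    {z : (S × W) × (U × R)} (h : graphNorm D E z.1 + pairNorm z.2 ≤ 0) : z = 0 := by
  obtain ⟨⟨σ, ω⟩, ⟨u, r⟩⟩ := z
  have h1 : 0 ≤ graphNorm D E (σ, ω) := Real.sqrt_nonneg _
  have h2 : 0 ≤ pairNorm (u, r) := Real.sqrt_nonneg _
  simp only at h
  have h3 : graphNorm D E (σ, ω) = 0 := by linarith
  have h4 : pairNorm (u, r) = 0 := by linarith
  rw [graphNorm, Real.sqrt_eq_zero (by positivity)] at h3
  rw [pairNorm, Real.sqrt_eq_zero (by positivity)] at h4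
  simp only at h3 h4
  have hσ : ‖σ‖ ^ 2 = 0 := by
    nlinarith [sq_nonneg ‖σ‖, sq_nonneg ‖D σ‖, sq_nonneg ‖ω‖, sq_nonneg ‖E ω‖]
  have hω : ‖ω‖ ^ 2 = 0 := by
    nlinarith [sq_nonneg ‖σ‖, sq_nonneg ‖D σ‖, sq_nonneg ‖ω‖, sq_nonneg ‖E ω‖]
  have hu : ‖u‖ ^ 2 = 0 := by nlinarith [sq_nonneg ‖u‖, sq_nonneg ‖r‖]
  have hr : ‖r‖ ^ 2 = 0 := by nlinarith [sq_nonneg ‖u‖, sq_nonneg ‖r‖]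
  simp only [ne_eq, OfNat.ofNat_ne_zero, not_false_eq_true, pow_eq_zero_iff, norm_eq_zero]
    at hσ hω hu hr
  simp [hσ, hω, hu, hr]

/-- Well-posedness of the finite-dimensional saddle point problem, with a bound that depends only
on the coercivity, boundedness and inf-sup constants. -/
theorem saddle_wellPosed [FiniteDimensional ℝ S] [FiniteDimensional ℝ W] [FiniteDimensional ℝ U]
    [FiniteDimensional ℝ R] (a : (S × W) →ₗ[ℝ] (S × W) →ₗ[ℝ] ℝ) (D : S →ₗ[ℝ] U) (J : S →ₗ[ℝ] R)
    (E : W →ₗ[ℝ] R) {c K β : ℝ} (hc : 0 < c) (hK : 0 ≤ K) (hβ : 0 < β)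
    (hcoer : ∀ x, c * (‖x.1‖ ^ 2 + ‖x.2‖ ^ 2) ≤ a x x)
    (hbdd : ∀ (x : S × W) (σ : S), a x (σ, 0) ≤ K * ‖x.1‖ * ‖σ‖)
    (hJ : ∀ σ, ‖J σ‖ ≤ 2 * ‖σ‖)
    (hinf : ∀ y : U × R, y ≠ 0 → ∃ σ : S, 0 < graphNorm D E (σ, 0) ∧
      β / 2 * (graphNorm D E (σ, 0) * pairNorm y) ≤ inner ℝ (D σ) y.1 + inner ℝ (J σ) y.2)
    {G F : ℝ} (hG : 0 ≤ G) (hF : 0 ≤ F) (g : (S × W) →ₗ[ℝ] ℝ) (f : (U × R) →ₗ[ℝ] ℝ)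
    (hg : ∀ x, |g x| ≤ G * graphNorm D E x) (hf : ∀ y, |f y| ≤ F * pairNorm y) :
    ∃ z : (S × W) × (U × R),
      (∀ y, saddleOp a (saddleB D J E) z y = g y.1 + f y.2) ∧
      (∀ z', (∀ y, saddleOp a (saddleB D J E) z' y = g y.1 + f y.2) → z' = z) ∧
      graphNorm D E z.1 + pairNorm z.2 ≤ saddleConst c K β * (G + F) := by
  have hinj : Function.Injective (saddleOp a (saddleB D J E)) := by
    rw [← LinearMap.ker_eq_bot, LinearMap.ker_eq_bot']
    intro z hz
    refine eq_zero_of_graphNorm_add_pairNorm (D := D) (E := E) ?_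
    -- The a priori estimate with `G = F = 0` shows that the kernel is trivial.
    have := saddle_estimate a D J E hc hK hβ hcoer hbdd hJ hinf le_rfl le_rfl
      (fun _ => 0) (fun _ => 0) (by simp) (by simp) z (by simp [hz])
    simpa using this
  -- A finite-dimensional space and its dual have the same dimension, so injectivity gives
  -- existence.
  have hsurj : Function.Surjective (saddleOp a (saddleB D J E)) :=
    (LinearMap.injective_iff_surjective_of_finrank_eq_finrank
      Subspace.dual_finrank_eq.symm).1 hinj
  obtain ⟨z, hz⟩ := hsurj (g.coprod f)
  have hz' : ∀ y, saddleOp a (saddleB D J E) z y = g y.1 + f y.2 := by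
    intro y; rw [hz, LinearMap.coprod_apply]
  refine ⟨z, hz', fun z' h => hinj (LinearMap.ext fun y => (h y).trans (hz' y).symm), ?_⟩
  exact saddle_estimate a D J E hc hK hβ hcoer hbdd hJ hinf hG hF g f hg hf z hz'

end Saddle

/-! ### Pointwise bounds for compliance and asymmetry -/

section Matrices

variable {d : ℕ}

/-- The compliance as a linear map. -/
noncomputable def complianceLin (mu muc lam : ℝ) : Mat d d →ₗ[ℝ] Mat d d where
  toFun := compliance mu muc lam
  map_add' σ τ := by
    have htr : trc (σ + τ) = trc σ + trc τ := by
      simp [trc, Finset.sum_add_distrib]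
    ext ⟨i, j⟩
    simp only [compliance, htr, symPart, skwPart, transp, PiLp.add_apply, PiLp.smul_apply,
      PiLp.sub_apply, smul_eq_mul]
    ring
  map_smul' c τ := by
    have htr : trc (c • τ) = c * trc τ := by
      simp [trc, Finset.mul_sum]
    ext ⟨i, j⟩
    simp only [compliance, htr, symPart, skwPart, transp, PiLp.add_apply, PiLp.smul_apply,
      PiLp.sub_apply, smul_eq_mul, RingHom.id_apply]
    ring

theorem mat_inner {p d : ℕ} (σ τ : Mat p d) : inner ℝ σ τ = ∑ i, ∑ j, σ (i, j) * τ (i, j) := by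
  rw [PiLp.inner_apply, Fintype.sum_prod_type]
  simp [mul_comm]

theorem inner_transp (σ τ : Mat d d) : inner ℝ (transp σ) (transp τ) = inner ℝ σ τ := by
  rw [mat_inner, mat_inner, Finset.sum_comm]
  rfl

theorem norm_transp (τ : Mat d d) : ‖transp τ‖ = ‖τ‖ := by
  rw [norm_eq_sqrt_real_inner, inner_transp, ← norm_eq_sqrt_real_inner]

theorem norm_symPart_le (τ : Mat d d) : ‖symPart τ‖ ≤ ‖τ‖ := by
  rw [symPart, norm_smul, Real.norm_of_nonneg (by norm_num)]
  have := norm_add_le τ (transp τ)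
  rw [norm_transp] at this
  linarith

theorem norm_skwPart_le (τ : Mat d d) : ‖skwPart τ‖ ≤ ‖τ‖ := by
  rw [skwPart, norm_smul, Real.norm_of_nonneg (by norm_num)]
  have := norm_sub_le τ (transp τ)
  rw [norm_transp] at this
  linarith

theorem symPart_add_skwPart (τ : Mat d d) : symPart τ + skwPart τ = τ := by
  rw [symPart, skwPart, ← smul_add, add_add_sub_cancel, ← two_smul ℝ, smul_smul]
  norm_num

theorem inner_symPart_skwPart (τ : Mat d d) : inner ℝ (symPart τ) (skwPart τ) = 0 := by
  have h : inner ℝ (transp τ) τ = inner ℝ τ (transp τ) := real_inner_comm _ _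
  simp only [symPart, skwPart, real_inner_smul_left, real_inner_smul_right, inner_add_left,
    inner_sub_right, inner_transp, h]
  ring

theorem norm_sq_eq_symPart_skwPart (τ : Mat d d) :
    ‖τ‖ ^ 2 = ‖symPart τ‖ ^ 2 + ‖skwPart τ‖ ^ 2 := by
  conv_lhs => rw [← symPart_add_skwPart τ]
  rw [norm_add_sq_real, inner_symPart_skwPart]
  ring

theorem inner_idMat (τ : Mat d d) : inner ℝ (idMat d) τ = trc τ := by
  rw [mat_inner]
  simp [idMat, trc]

theorem norm_idMat_sq : ‖idMat d‖ ^ 2 = d := by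
  rw [← real_inner_self_eq_norm_sq, inner_idMat]
  simp [idMat, trc]

theorem trc_symPart (τ : Mat d d) : trc (symPart τ) = trc τ := by
  simp only [trc, symPart, transp, PiLp.smul_apply, PiLp.add_apply, smul_eq_mul]
  exact Finset.sum_congr rfl fun i _ => by ring

/-- Cauchy–Schwarz against the identity matrix, whose squared Frobenius norm is `d`. -/
theorem trc_sq_le (τ : Mat d d) : trc τ ^ 2 ≤ d * ‖τ‖ ^ 2 := by
  rw [← inner_idMat, ← norm_idMat_sq, ← mul_pow]
  exact sq_le_sq.2 ((abs_real_inner_le_norm _ _).trans (le_abs_self _))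

theorem norm_trc_smul_idMat_le (τ : Mat d d) : ‖trc τ • idMat d‖ ≤ d * ‖τ‖ := by
  rw [norm_smul, Real.norm_eq_abs, ← inner_idMat, ← norm_idMat_sq]
  have := mul_le_mul_of_nonneg_right (abs_real_inner_le_norm (idMat d) τ) (norm_nonneg (idMat d))
  linarith

variable {m M mu muc lam : ℝ}

/-- The trace term has norm at most `‖τ‖` because `dλ / (2μ + dλ) ≤ 1`, which keeps the bound
independent of `λ`. The `3` counts the symmetric part, the trace term and the skew part. -/
theorem norm_compliance_le (hm : 0 < m) (hmu : m ≤ mu) (hmuc : m ≤ muc) (hlam : 0 ≤ lam)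
    (τ : Mat d d) : ‖compliance mu muc lam τ‖ ≤ 3 / (2 * m) * ‖τ‖ := by
  have hmu0 : 0 < mu := hm.trans_le hmu
  have hmuc0 : 0 < muc := hm.trans_le hmuc
  have h0 : 0 < 2 * mu + d * lam := by positivity
  have h1 : ‖(lam / (2 * mu + d * lam) * trc τ) • idMat d‖ ≤ ‖τ‖ := by
    rw [mul_smul, norm_smul, Real.norm_of_nonneg (by positivity)]
    calc _ ≤ lam / (2 * mu + d * lam) * (d * ‖τ‖) :=
          mul_le_mul_of_nonneg_left (norm_trc_smul_idMat_le τ) (by positivity)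
      _ = (d * lam / (2 * mu + d * lam)) * ‖τ‖ := by ring
      _ ≤ 1 * ‖τ‖ := by
          refine mul_le_mul_of_nonneg_right ?_ (norm_nonneg _)
          rw [div_le_one h0]; linarith
      _ = ‖τ‖ := one_mul _
  have h2 : ‖symPart τ - (lam / (2 * mu + d * lam) * trc τ) • idMat d‖ ≤ 2 * ‖τ‖ :=
    (norm_sub_le _ _).trans (by linarith [norm_symPart_le τ])
  have h3 : 1 / (2 * mu) ≤ 1 / (2 * m) := one_div_le_one_div_of_le (by positivity) (by linarith)
  have h4 : 1 / (2 * muc) ≤ 1 / (2 * m) := one_div_le_one_div_of_le (by positivity) (by linarith)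
  have h5 : 0 < 1 / (2 * m) := by positivity
  refine (norm_add_le _ _).trans ?_
  rw [norm_smul, norm_smul, Real.norm_of_nonneg (by positivity),
    Real.norm_of_nonneg (by positivity)]
  have h6 := mul_le_mul h3 h2 (norm_nonneg _) h5.le
  have h7 := mul_le_mul h4 (norm_skwPart_le τ) (norm_nonneg _) h5.le
  have h8 : 3 / (2 * m) * ‖τ‖ = 1 / (2 * m) * (2 * ‖τ‖) + 1 / (2 * m) * ‖τ‖ := by ring
  linarith

/-- Symmetric and skew parts are orthogonal, so the quadratic form splits. On the symmetric part the
worst direction is the identity, with eigenvalue `1 / (2μ + dλ)`; on the skew part the eigenvalue is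
`1 / (2μᶜ)`. Since `d ≤ 3`, both are at least `1 / (2M + 3M)`. -/
theorem inner_compliance_ge (hd : (d : ℝ) ≤ 3) (hm : 0 < m) (hmu : mu ∈ Set.Icc m M)
    (hmuc : muc ∈ Set.Icc m M) (hlam : lam ∈ Set.Icc 0 M) (τ : Mat d d) :
    1 / (5 * M) * ‖τ‖ ^ 2 ≤ inner ℝ (compliance mu muc lam τ) τ := by
  have hmu0 : 0 < mu := hm.trans_le hmu.1
  have hmuc0 : 0 < muc := hm.trans_le hmuc.1
  have hlam0 : 0 ≤ lam := hlam.1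
  have hd0 : (0 : ℝ) ≤ d := Nat.cast_nonneg d
  have hM0 : 0 < M := hmu0.trans_le hmu.2
  have h0 : 0 < 2 * mu + d * lam := by positivity
  have hsym : inner ℝ (symPart τ) τ = ‖symPart τ‖ ^ 2 := by
    conv_lhs => rw [← symPart_add_skwPart τ]
    rw [inner_add_right]
    rw [show inner ℝ (symPart (symPart τ + skwPart τ)) (skwPart τ) = 0 by
      rw [symPart_add_skwPart, inner_symPart_skwPart], symPart_add_skwPart,
      real_inner_self_eq_norm_sq, add_zero]
  have hskw : inner ℝ (skwPart τ) τ = ‖skwPart τ‖ ^ 2 := by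
    have h1 : inner ℝ (symPart τ + skwPart τ) τ = ‖τ‖ ^ 2 := by
      rw [symPart_add_skwPart, real_inner_self_eq_norm_sq]
    rw [inner_add_left, hsym, norm_sq_eq_symPart_skwPart τ] at h1
    linarith
  have hval : inner ℝ (compliance mu muc lam τ) τ
      = 1 / (2 * mu) * (‖symPart τ‖ ^ 2 - lam / (2 * mu + d * lam) * trc τ ^ 2)
        + 1 / (2 * muc) * ‖skwPart τ‖ ^ 2 := by
    rw [compliance, inner_add_left, real_inner_smul_left, real_inner_smul_left, inner_sub_left,
      real_inner_smul_left, inner_idMat, hsym, hskw]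
    ring
  have htr : trc τ ^ 2 ≤ d * ‖symPart τ‖ ^ 2 := by
    rw [← trc_symPart]; exact trc_sq_le _
  have h1 : 1 / (2 * mu + d * lam) * ‖symPart τ‖ ^ 2
      ≤ 1 / (2 * mu) * (‖symPart τ‖ ^ 2 - lam / (2 * mu + d * lam) * trc τ ^ 2) := by
    calc 1 / (2 * mu + d * lam) * ‖symPart τ‖ ^ 2
        = 1 / (2 * mu) *
          (‖symPart τ‖ ^ 2 - lam / (2 * mu + d * lam) * (d * ‖symPart τ‖ ^ 2)) := by
          field_simp
          ring
      _ ≤ _ := by gcongr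
  have h2 : 1 / (5 * M) ≤ 1 / (2 * mu + d * lam) := by
    refine one_div_le_one_div_of_le h0 ?_
    nlinarith [hmu.2, hlam.2, mul_le_mul_of_nonneg_right hd hlam0]
  have h3 : 1 / (5 * M) ≤ 1 / (2 * muc) :=
    one_div_le_one_div_of_le (by positivity) (by linarith [hmuc.2])
  rw [hval, norm_sq_eq_symPart_skwPart, mul_add]
  exact add_le_add ((mul_le_mul_of_nonneg_right h2 (sq_nonneg _)).trans h1)
    (mul_le_mul_of_nonneg_right h3 (sq_nonneg _))

theorem continuous_transp : Continuous (transp (d := d)) := by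
  unfold transp; fun_prop

theorem continuous_trc : Continuous (trc (d := d)) := by
  unfold trc; fun_prop

theorem aestronglyMeasurable_compliance {α : Type*} [MeasurableSpace α] {ν : Measure α}
    {mu muc lam : α → ℝ} {τ : α → Mat d d} (hmu : Measurable mu) (hmuc : Measurable muc)
    (hlam : Measurable lam) (hτ : AEStronglyMeasurable τ ν) :
    AEStronglyMeasurable (fun x => compliance (mu x) (muc x) (lam x) (τ x)) ν := by
  have h1 := continuous_transp.comp_aestronglyMeasurable hτ
  have h2 := continuous_trc.comp_aestronglyMeasurable hτ
  have hc : ∀ {r : α → ℝ}, Measurable r → AEStronglyMeasurable r ν :=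
    fun h => h.aestronglyMeasurable
  have ha : Measurable fun x => 1 / (2 * mu x) := by fun_prop
  have hb : Measurable fun x => 1 / (2 * muc x) := by fun_prop
  have he : Measurable fun x => lam x / (2 * mu x + d * lam x) := by fun_prop
  exact ((hc ha).smul (((hτ.add h1).const_smul (1 / 2 : ℝ)).sub
    (((hc he).mul h2).smul aestronglyMeasurable_const))).add
      ((hc hb).smul ((hτ.sub h1).const_smul (1 / 2 : ℝ)))

/-- The couple-stress compliance as a linear map. -/
noncomputable def coupleComplianceLin : (d : ℕ) → (mu muc lam : ℝ) →
    Mat (rotDim d) d →ₗ[ℝ] Mat (rotDim d) d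
  | 3, mu, muc, lam => (complianceLin (d := 3) mu muc lam : Mat 3 3 →ₗ[ℝ] Mat 3 3)
  | 0, mu, _, _ | 1, mu, _, _ | 2, mu, _, _ | _ + 4, mu, _, _ => (1 / (2 * mu)) • LinearMap.id

theorem coupleComplianceLin_apply (hd : d = 2 ∨ d = 3) (mu muc lam : ℝ) (τ : Mat (rotDim d) d) :
    coupleComplianceLin d mu muc lam τ = coupleCompliance d mu muc lam τ := by
  rcases hd with rfl | rfl <;> rfl

theorem norm_coupleCompliance_le (hd : d = 2 ∨ d = 3) (hm : 0 < m) (hmu : m ≤ mu)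
    (hmuc : m ≤ muc) (hlam : 0 ≤ lam) (τ : Mat (rotDim d) d) :
    ‖coupleCompliance d mu muc lam τ‖ ≤ 3 / (2 * m) * ‖τ‖ := by
  rcases hd with rfl | rfl
  · have hmu0 : 0 < mu := hm.trans_le hmu
    change ‖(1 / (2 * mu)) • τ‖ ≤ _
    rw [norm_smul, Real.norm_of_nonneg (by positivity)]
    refine mul_le_mul_of_nonneg_right ?_ (norm_nonneg _)
    exact div_le_div₀ (by norm_num) (by norm_num) (by positivity) (by linarith)
  · exact norm_compliance_le (d := 3) hm hmu hmuc hlam τ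

theorem inner_coupleCompliance_ge (hd : d = 2 ∨ d = 3) (hm : 0 < m) (hmu : mu ∈ Set.Icc m M)
    (hmuc : muc ∈ Set.Icc m M) (hlam : lam ∈ Set.Icc 0 M) (τ : Mat (rotDim d) d) :
    1 / (5 * M) * ‖τ‖ ^ 2 ≤ inner ℝ (coupleCompliance d mu muc lam τ) τ := by
  rcases hd with rfl | rfl
  · have hmu0 : 0 < mu := hm.trans_le hmu.1
    change _ ≤ inner ℝ ((1 / (2 * mu)) • τ) τ
    rw [real_inner_smul_left, real_inner_self_eq_norm_sq]
    refine mul_le_mul_of_nonneg_right ?_ (sq_nonneg _)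
    exact one_div_le_one_div_of_le (by positivity) (by linarith [hmu.2])
  · exact inner_compliance_ge (d := 3) (by norm_num) hm hmu hmuc hlam τ

theorem aestronglyMeasurable_coupleCompliance (hd : d = 2 ∨ d = 3) {α : Type*}
    [MeasurableSpace α] {ν : Measure α} {mu muc lam : α → ℝ} {τ : α → Mat (rotDim d) d}
    (hmu : Measurable mu) (hmuc : Measurable muc) (hlam : Measurable lam)
    (hτ : AEStronglyMeasurable τ ν) :
    AEStronglyMeasurable (fun x => coupleCompliance d (mu x) (muc x) (lam x) (τ x)) ν := by
  rcases hd with rfl | rfl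
  · have ha : Measurable fun x => 1 / (2 * mu x) := by fun_prop
    exact ha.aestronglyMeasurable.smul hτ
  · exact aestronglyMeasurable_compliance (d := 3) hmu hmuc hlam hτ

/-- The asymmetry operator as a linear map. -/
noncomputable def asymLin (hd : d = 2 ∨ d = 3) : Mat d d →ₗ[ℝ] Vec (rotDim d) where
  toFun := asym d
  map_add' σ τ := by
    rcases hd with rfl | rfl
    · ext i
      simp only [asym, PiLp.add_apply]
      ring
    -- `rotDim 3` is a binomial coefficient that equals `3` by computation; naming the index type
    -- exposes the three components.
    · apply PiLp.ext (ι := Fin 3)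
      intro i
      fin_cases i
      exacts [add_sub_add_comm (σ (2, 1)) (τ (2, 1)) (σ (1, 2)) (τ (1, 2)),
        add_sub_add_comm (σ (0, 2)) (τ (0, 2)) (σ (2, 0)) (τ (2, 0)),
        add_sub_add_comm (σ (1, 0)) (τ (1, 0)) (σ (0, 1)) (τ (0, 1))]
  map_smul' c τ := by
    rcases hd with rfl | rfl
    · ext i
      simp only [asym, PiLp.smul_apply, smul_eq_mul, RingHom.id_apply]
      ring
    · apply PiLp.ext (ι := Fin 3)
      intro i
      fin_cases i
      exacts [(mul_sub c (τ (2, 1)) (τ (1, 2))).symm, (mul_sub c (τ (0, 2)) (τ (2, 0))).symm,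
        (mul_sub c (τ (1, 0)) (τ (0, 1))).symm]

/-- Each component obeys `(a - b)² ≤ 2 (a² + b²)`, and distinct components involve distinct entries.
The sharp constant is `√2`; `2` avoids the root. -/
theorem norm_asym_le (hd : d = 2 ∨ d = 3) (τ : Mat d d) : ‖asym d τ‖ ≤ 2 * ‖τ‖ := by
  refine abs_le_of_sq_le_sq' ?_ (by positivity) |>.2
  rw [mul_pow, ← real_inner_self_eq_norm_sq τ, mat_inner]
  rcases hd with rfl | rfl
  · have : ‖asym 2 τ‖ ^ 2 = (τ (1, 0) - τ (0, 1)) ^ 2 := by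
      have h := EuclideanSpace.real_norm_sq_eq (n := Fin 1) (asym 2 τ)
      exact h.trans (by simp [asym])
    rw [this]
    simp only [Fin.sum_univ_two]
    nlinarith [sq_nonneg (τ (1, 0) + τ (0, 1)), sq_nonneg (τ (0, 0)), sq_nonneg (τ (1, 1)),
      sq_nonneg (τ (1, 0)), sq_nonneg (τ (0, 1))]
  · have : ‖asym 3 τ‖ ^ 2 = (τ (2, 1) - τ (1, 2)) ^ 2 + (τ (0, 2) - τ (2, 0)) ^ 2
        + (τ (1, 0) - τ (0, 1)) ^ 2 := by
      have h := EuclideanSpace.real_norm_sq_eq (n := Fin 3) (asym 3 τ)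
      exact h.trans (by simp [asym, Fin.sum_univ_three])
    rw [this]
    simp only [Fin.sum_univ_three]
    nlinarith [sq_nonneg (τ (1, 0) + τ (0, 1)), sq_nonneg (τ (2, 1) + τ (1, 2)),
      sq_nonneg (τ (0, 2) + τ (2, 0)), sq_nonneg (τ (0, 0)), sq_nonneg (τ (1, 1)),
      sq_nonneg (τ (2, 2)), sq_nonneg (τ (1, 0)), sq_nonneg (τ (0, 1)), sq_nonneg (τ (2, 1)),
      sq_nonneg (τ (1, 2)), sq_nonneg (τ (0, 2)), sq_nonneg (τ (2, 0))]

end Matrices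

/-! ### Pointwise linear maps acting on `L²` -/

section Pointwise

variable {d : ℕ} {Ω : Set (Vec d)} {F G : Type} [NormedAddCommGroup F] [InnerProductSpace ℝ F]
  [NormedAddCommGroup G] [InnerProductSpace ℝ G]

/-- A measurable, uniformly bounded family of linear maps acts on `L²`. -/
theorem exists_pointwiseOp (hΩ : MeasurableSet Ω) (T : Vec d → F →ₗ[ℝ] G) {K : ℝ}
    (hK : ∀ x ∈ Ω, ∀ v, ‖T x v‖ ≤ K * ‖v‖)
    (hmeas : ∀ σ : L2 Ω F, AEStronglyMeasurable (fun x => T x (σ x))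
      ((volume : Measure (Vec d)).restrict Ω)) :
    ∃ A : L2 Ω F →ₗ[ℝ] L2 Ω G,
      (∀ σ, A σ =ᵐ[(volume : Measure (Vec d)).restrict Ω] fun x => T x (σ x)) ∧
      ∀ σ, ‖A σ‖ ≤ K * ‖σ‖ := by
  have hb : ∀ σ : L2 Ω F, ∀ᵐ x ∂((volume : Measure (Vec d)).restrict Ω),
      ‖T x (σ x)‖ ≤ K * ‖σ x‖ := fun σ => by
    filter_upwards [ae_restrict_mem hΩ] with x hx using hK x hx _
  have hmem : ∀ σ : L2 Ω F, MemLp (fun x => T x (σ x)) 2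
      ((volume : Measure (Vec d)).restrict Ω) :=
    fun σ => (Lp.memLp σ).of_le_mul (hmeas σ) (hb σ)
  refine ⟨{ toFun := fun σ => (hmem σ).toLp _, map_add' := ?_, map_smul' := ?_ }, ?_, ?_⟩
  · intro σ τ
    rw [← MemLp.toLp_add]
    refine MemLp.toLp_congr _ _ ?_
    filter_upwards [Lp.coeFn_add σ τ] with x hx
    exact (congrArg (T x) hx).trans (map_add (T x) _ _)
  · intro c σ
    rw [RingHom.id_apply, ← MemLp.toLp_const_smul]
    refine MemLp.toLp_congr _ _ ?_
    filter_upwards [Lp.coeFn_smul c σ] with x hx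
    exact (congrArg (T x) hx).trans (map_smul (T x) _ _)
  · intro σ
    exact (hmem σ).coeFn_toLp
  · intro σ
    refine Lp.norm_le_mul_norm_of_ae_le_mul ?_
    filter_upwards [hb σ, (hmem σ).coeFn_toLp] with x hx hx'
    rw [LinearMap.coe_mk, AddHom.coe_mk, hx']
    exact hx

theorem pairing_eq_inner (φ ψ : L2 Ω F) : pairing Ω φ ψ = inner ℝ φ ψ :=
  (L2.inner_def φ ψ).symm

theorem pairing_eq_inner_of_ae {φ : Vec d → F} {Φ : L2 Ω F}
    (h : Φ =ᵐ[(volume : Measure (Vec d)).restrict Ω] φ) (ψ : L2 Ω F) :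
    pairing Ω φ ψ = inner ℝ Φ ψ := by
  rw [← pairing_eq_inner]
  refine integral_congr_ae ?_
  filter_upwards [h] with x hx
  rw [hx]

theorem inner_ge_of_ae {c : ℝ} {Φ σ : L2 Ω F}
    (h : ∀ᵐ x ∂((volume : Measure (Vec d)).restrict Ω), c * ‖σ x‖ ^ 2 ≤ inner ℝ (Φ x) (σ x)) :
    c * ‖σ‖ ^ 2 ≤ inner ℝ Φ σ := by
  rw [← real_inner_self_eq_norm_sq, L2.inner_def, L2.inner_def, ← integral_const_mul]
  refine integral_mono_ae ((L2.integrable_inner σ σ).const_mul c) (L2.integrable_inner Φ σ) ?_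
  filter_upwards [h] with x hx
  simpa [real_inner_self_eq_norm_sq] using hx

end Pointwise

/-! ### Linearity of the weak divergence -/

section WeakDiv

variable {p d : ℕ} {Ω : Set (Vec d)}

theorem integrable_coord_mul {ι : Type} [Fintype ι] (σ : L2 Ω (EuclideanSpace ℝ ι)) (i : ι)
    {ψ : Vec d → ℝ} (hψ : Continuous ψ) (hc : HasCompactSupport ψ) :
    Integrable (fun x => σ x i * ψ x) ((volume : Measure (Vec d)).restrict Ω) := by
  have h1 : MemLp (fun x => σ x i) 2 ((volume : Measure (Vec d)).restrict Ω) :=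
    (EuclideanSpace.proj (𝕜 := ℝ) i).comp_memLp' (Lp.memLp σ)
  simpa only [smul_eq_mul, mul_comm] using
    (h1.locallyIntegrable (by norm_num)).integrable_smul_left_of_hasCompactSupport hψ hc

theorem continuous_partialDeriv {φ : Vec d → ℝ} (hφ : ContDiff ℝ (⊤ : ℕ∞) φ) (j : Fin d) :
    Continuous (partialDeriv j φ) :=
  (hφ.continuous_fderiv (by simp)).clm_apply continuous_const

theorem hasCompactSupport_partialDeriv {φ : Vec d → ℝ} (hc : HasCompactSupport φ) (j : Fin d) :
    HasCompactSupport (partialDeriv j φ) :=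
  hc.fderiv_apply (𝕜 := ℝ) _

theorem integrable_sum_mul_partialDeriv (σ : L2 Ω (Mat p d)) (i : Fin p) {φ : Vec d → ℝ}
    (hφ : ContDiff ℝ (⊤ : ℕ∞) φ) (hc : HasCompactSupport φ) :
    Integrable (fun x => ∑ j, σ x (i, j) * partialDeriv j φ x)
      ((volume : Measure (Vec d)).restrict Ω) :=
  integrable_finsetSum _ fun j _ => integrable_coord_mul σ (i, j) (continuous_partialDeriv hφ j)
    (hasCompactSupport_partialDeriv hc j)

theorem IsWeakDiv.congr_ae {τ τ' : Vec d → Mat p d} {g : L2 Ω (Vec p)}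
    (h : τ =ᵐ[(volume : Measure (Vec d)).restrict Ω] τ') (hg : IsWeakDiv Ω τ g) :
    IsWeakDiv Ω τ' g := by
  intro φ hφ hc hs i
  rw [← hg φ hφ hc hs i]
  refine integral_congr_ae ?_
  filter_upwards [h] with x hx
  rw [hx]

theorem IsWeakDiv.add {σ τ : L2 Ω (Mat p d)} {g k : L2 Ω (Vec p)} (hg : IsWeakDiv Ω σ g)
    (hk : IsWeakDiv Ω τ k) : IsWeakDiv Ω (σ + τ : L2 Ω (Mat p d)) (g + k) := by
  intro φ hφ hc hs i
  have h1 : ∫ x in Ω, ∑ j, (σ + τ : L2 Ω (Mat p d)) x (i, j) * partialDeriv j φ x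
      = ∫ x in Ω, (∑ j, σ x (i, j) * partialDeriv j φ x
          + ∑ j, τ x (i, j) * partialDeriv j φ x) := by
    refine integral_congr_ae ?_
    filter_upwards [Lp.coeFn_add σ τ] with x hx
    rw [hx, ← Finset.sum_add_distrib]
    exact Finset.sum_congr rfl fun j _ => add_mul _ _ _
  have h2 : ∫ x in Ω, (g + k : L2 Ω (Vec p)) x i * φ x
      = ∫ x in Ω, (g x i * φ x + k x i * φ x) := by
    refine integral_congr_ae ?_
    filter_upwards [Lp.coeFn_add g k] with x hx
    rw [hx]
    exact add_mul _ _ _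
  rw [h1, h2, integral_add (integrable_sum_mul_partialDeriv σ i hφ hc)
    (integrable_sum_mul_partialDeriv τ i hφ hc),
    integral_add (integrable_coord_mul g i hφ.continuous hc)
    (integrable_coord_mul k i hφ.continuous hc), hg φ hφ hc hs i, hk φ hφ hc hs i]
  ring

theorem IsWeakDiv.smul (c : ℝ) {σ : L2 Ω (Mat p d)} {g : L2 Ω (Vec p)} (hg : IsWeakDiv Ω σ g) :
    IsWeakDiv Ω (c • σ : L2 Ω (Mat p d)) (c • g) := by
  intro φ hφ hc hs i
  have h1 : ∫ x in Ω, ∑ j, (c • σ : L2 Ω (Mat p d)) x (i, j) * partialDeriv j φ x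
      = ∫ x in Ω, c * ∑ j, σ x (i, j) * partialDeriv j φ x := by
    refine integral_congr_ae ?_
    filter_upwards [Lp.coeFn_smul c σ] with x hx
    rw [hx, Finset.mul_sum]
    exact Finset.sum_congr rfl fun j _ => mul_assoc _ _ _
  have h2 : ∫ x in Ω, (c • g : L2 Ω (Vec p)) x i * φ x = ∫ x in Ω, c * (g x i * φ x) := by
    refine integral_congr_ae ?_
    filter_upwards [Lp.coeFn_smul c g] with x hx
    rw [hx]
    exact mul_assoc _ _ _
  rw [h1, h2, integral_const_mul, integral_const_mul, hg φ hφ hc hs i]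
  ring

theorem exists_isWeakDiv_weakDiv {τ : Vec d → Mat p d} (h : ∃ g : L2 Ω (Vec p), IsWeakDiv Ω τ g) :
    IsWeakDiv Ω τ (weakDiv Ω τ) := by
  rw [weakDiv, dif_pos h]
  exact h.choose_spec

/-- On a subspace of fields whose images under a linear operator have a divergence in `L²`, the
divergence of the image is linear. -/
theorem exists_weakDivLin (hΩ : IsOpen Ω) (V : Submodule ℝ (L2 Ω (Mat p d)))
    (T : L2 Ω (Mat p d) →ₗ[ℝ] L2 Ω (Mat p d)) (τ : L2 Ω (Mat p d) → Vec d → Mat p d)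
    (hT : ∀ σ, T σ =ᵐ[(volume : Measure (Vec d)).restrict Ω] τ σ)
    (hex : ∀ σ ∈ V, ∃ g : L2 Ω (Vec p), IsWeakDiv Ω (τ σ) g) :
    ∃ D : V →ₗ[ℝ] L2 Ω (Vec p), ∀ σ : V, D σ = weakDiv Ω (τ σ) := by
  -- `T σ` is the `L²` class of the function `τ σ`, to which the sum and scaling rules apply.
  -- Linearity of the chosen divergence then follows from uniqueness.
  have hdiv : ∀ σ : V, IsWeakDiv Ω (T σ) (weakDiv Ω (τ σ)) := fun σ =>
    (exists_isWeakDiv_weakDiv (hex σ σ.2)).congr_ae (hT σ).symm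
  refine ⟨{ toFun := fun σ => weakDiv Ω (τ σ), map_add' := ?_, map_smul' := ?_ }, fun _ => rfl⟩
  · intro σ σ'
    refine IsWeakDiv.weakDiv_eq hΩ (IsWeakDiv.congr_ae (hT _) ?_)
    rw [Submodule.coe_add, map_add]
    exact (hdiv σ).add (hdiv σ')
  · intro c σ
    refine IsWeakDiv.weakDiv_eq hΩ (IsWeakDiv.congr_ae (hT _) ?_)
    rw [Submodule.coe_smul, map_smul]
    exact (hdiv σ).smul c

end WeakDiv

/-! ### The dual norm as a supremum of quotients -/

section DualNorm

variable {V : Type*} [NormedAddCommGroup V] [NormedSpace ℝ V] [FiniteDimensional ℝ V] {n : V → ℝ}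

/-- In finite dimension `g` is continuous, so the quotients are bounded above and the real supremum
is a genuine one. This needs of `n` only that it dominates the norm. -/
theorem le_iSup_div_mul (hn : ∀ v, ‖v‖ ≤ n v) (g : V →ₗ[ℝ] ℝ) (v : V) :
    g v ≤ (⨆ η, g η / n η) * n v := by
  have hle : ∀ η, g η ≤ ‖LinearMap.toContinuousLinearMap g‖ * n η := fun η =>
    (le_abs_self _).trans (((LinearMap.toContinuousLinearMap g).le_opNorm η).trans
      (mul_le_mul_of_nonneg_left (hn η) (norm_nonneg _)))
  have hbdd : BddAbove (Set.range fun η => g η / n η) := by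
    refine ⟨‖LinearMap.toContinuousLinearMap g‖, ?_⟩
    rintro _ ⟨η, rfl⟩
    exact div_le_of_le_mul₀ ((norm_nonneg _).trans (hn η)) (norm_nonneg _) (hle η)
  rcases ((norm_nonneg v).trans (hn v)).eq_or_lt with h0 | h0
  -- If `n v = 0` the quotient carries no information, but the operator norm bound already gives `g
  -- v ≤ 0`.
  · have := hle v
    rw [← h0] at this ⊢
    simpa using this
  · rw [← div_le_iff₀ h0]
    exact le_ciSup hbdd v

theorem abs_le_iSup_div_mul (hn : ∀ v, ‖v‖ ≤ n v) (hneg : ∀ v, n (-v) = n v) (g : V →ₗ[ℝ] ℝ)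
    (v : V) : |g v| ≤ (⨆ η, g η / n η) * n v :=
  abs_le'.2 ⟨le_iSup_div_mul hn g v, by simpa [hneg] using le_iSup_div_mul hn g (-v)⟩

theorem iSup_div_nonneg (hn : ∀ v, ‖v‖ ≤ n v) (g : V →ₗ[ℝ] ℝ) : 0 ≤ ⨆ η, g η / n η := by
  by_cases h : ∃ η, 0 < g η
  · obtain ⟨η, hη⟩ := h
    exact (pos_of_mul_pos_left (hη.trans_le (le_iSup_div_mul hn g η))
      ((norm_nonneg _).trans (hn η))).le
  · push Not at h
    have hz : ∀ η, g η = 0 := fun η => le_antisymm (h η) (by simpa using h (-η))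
    simp [hz]

end DualNorm

/-! ### Forms, functionals and norms on the discrete spaces -/

/-- The bilinear form `⟨A₁ σ, σ'⟩ + ⟨A₂ ω, ω'⟩` on a pair of subspaces. -/
noncomputable def energyForm {H₁ H₂ : Type*} [NormedAddCommGroup H₁] [InnerProductSpace ℝ H₁]
    [NormedAddCommGroup H₂] [InnerProductSpace ℝ H₂] (A₁ : H₁ →ₗ[ℝ] H₁) (A₂ : H₂ →ₗ[ℝ] H₂)
    (S : Submodule ℝ H₁) (W : Submodule ℝ H₂) : (S × W) →ₗ[ℝ] (S × W) →ₗ[ℝ] ℝ :=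
  LinearMap.mk₂ ℝ (fun x y => inner ℝ (A₁ x.1) (y.1 : H₁) + inner ℝ (A₂ x.2) (y.2 : H₂))
    (by intro x x' y
        simp only [Prod.fst_add, Prod.snd_add, Submodule.coe_add, map_add, inner_add_left]; ring)
    (by intro c x y
        simp only [Prod.smul_fst, Prod.smul_snd, Submodule.coe_smul, map_smul,
          real_inner_smul_left, smul_eq_mul]; ring)
    (by intro x y y'
        simp only [Prod.fst_add, Prod.snd_add, Submodule.coe_add, inner_add_right]; ring)
    (by intro c x y
        simp only [Prod.smul_fst, Prod.smul_snd, Submodule.coe_smul, real_inner_smul_right,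
          smul_eq_mul]; ring)

theorem energyForm_apply {H₁ H₂ : Type*} [NormedAddCommGroup H₁] [InnerProductSpace ℝ H₁]
    [NormedAddCommGroup H₂] [InnerProductSpace ℝ H₂] (A₁ : H₁ →ₗ[ℝ] H₁) (A₂ : H₂ →ₗ[ℝ] H₂)
    (S : Submodule ℝ H₁) (W : Submodule ℝ H₂) (x y : S × W) :
    energyForm A₁ A₂ S W x y = inner ℝ (A₁ x.1) (y.1 : H₁) + inner ℝ (A₂ x.2) (y.2 : H₂) := rfl

theorem pairNorm_coe {H₁ H₂ : Type*} [NormedAddCommGroup H₁] [InnerProductSpace ℝ H₁]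
    [NormedAddCommGroup H₂] [InnerProductSpace ℝ H₂] {U : Submodule ℝ H₁} {R : Submodule ℝ H₂}
    (y : U × R) : ‖(WithLp.toLp 2 ((y.1 : H₁), (y.2 : H₂)) : WithLp 2 (H₁ × H₂))‖ = pairNorm y :=
  WithLp.prod_norm_eq_of_L2 _

/-- The restriction of a functional on the Hilbert product to a pair of subspaces. -/
noncomputable def restrictPair {H₁ H₂ : Type*} [NormedAddCommGroup H₁] [InnerProductSpace ℝ H₁]
    [NormedAddCommGroup H₂] [InnerProductSpace ℝ H₂] (U : Submodule ℝ H₁) (R : Submodule ℝ H₂)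
    (f : StrongDual ℝ (WithLp 2 (H₁ × H₂))) : (U × R) →ₗ[ℝ] ℝ :=
  f.toLinearMap ∘ₗ (WithLp.linearEquiv 2 ℝ (H₁ × H₂)).symm.toLinearMap ∘ₗ
    (U.subtype.prodMap R.subtype)

theorem restrictPair_apply {H₁ H₂ : Type*} [NormedAddCommGroup H₁] [InnerProductSpace ℝ H₁]
    [NormedAddCommGroup H₂] [InnerProductSpace ℝ H₂] (U : Submodule ℝ H₁) (R : Submodule ℝ H₂)
    (f : StrongDual ℝ (WithLp 2 (H₁ × H₂))) (y : U × R) :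
    restrictPair U R f y = f (WithLp.toLp 2 ((y.1 : H₁), (y.2 : H₂))) := rfl

section GraphNorm

variable {S W U R : Type*}
  [NormedAddCommGroup S] [NormedSpace ℝ S] [NormedAddCommGroup W] [NormedSpace ℝ W]
  [NormedAddCommGroup U] [InnerProductSpace ℝ U] [NormedAddCommGroup R] [InnerProductSpace ℝ R]
  (D : S →ₗ[ℝ] U) (E : W →ₗ[ℝ] R)

theorem norm_le_graphNorm (x : S × W) : ‖x‖ ≤ graphNorm D E x :=
  max_le
    (Real.le_sqrt_of_sq_le (by
      nlinarith [sq_nonneg ‖D x.1‖, sq_nonneg ‖x.2‖, sq_nonneg ‖E x.2‖]))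
    (Real.le_sqrt_of_sq_le (by
      nlinarith [sq_nonneg ‖D x.1‖, sq_nonneg ‖x.1‖, sq_nonneg ‖E x.2‖]))

theorem graphNorm_neg (x : S × W) : graphNorm D E (-x) = graphNorm D E x := by
  simp [graphNorm]

theorem graphNorm_fst (σ : S) : graphNorm D E (σ, 0) = Real.sqrt (‖σ‖ ^ 2 + ‖D σ‖ ^ 2) := by
  simp [graphNorm]

end GraphNorm

/-! ### The concrete operators on `L²` -/

section Operators

variable {d : ℕ} {Ω : Set (Vec d)} {P : Material d} {m M : ℝ}

theorem exists_complianceOp (hd : d = 2 ∨ d = 3) (hm : 0 < m) (hΩ : MeasurableSet Ω)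
    (hP : P.Admissible Ω m M) :
    ∃ A : L2 Ω (Mat d d) →ₗ[ℝ] L2 Ω (Mat d d),
      (∀ σ σ' : L2 Ω (Mat d d),
        pairing Ω (fun x => compliance (P.muS x) (P.mucS x) (P.lamS x) (σ x)) σ'
          = inner ℝ (A σ) σ') ∧
      (∀ σ, ‖A σ‖ ≤ 3 / (2 * m) * ‖σ‖) ∧ ∀ σ, 1 / (5 * M) * ‖σ‖ ^ 2 ≤ inner ℝ (A σ) σ := by
  obtain ⟨A, hA, hAn⟩ := exists_pointwiseOp hΩ
    (fun x => complianceLin (d := d) (P.muS x) (P.mucS x) (P.lamS x)) (K := 3 / (2 * m))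
    (fun x hx v => norm_compliance_le hm (hP.muS_mem x hx).1 (hP.mucS_mem x hx).1
      (hP.lamS_mem x hx).1 v)
    (fun σ => aestronglyMeasurable_compliance hP.measurable.1 hP.measurable.2.1
      hP.measurable.2.2.1 (Lp.aestronglyMeasurable σ))
  refine ⟨A, fun σ σ' => pairing_eq_inner_of_ae (hA σ) σ', hAn, fun σ => inner_ge_of_ae ?_⟩
  filter_upwards [hA σ, ae_restrict_mem hΩ] with x hx hxΩ
  rw [hx]
  exact inner_compliance_ge (by rcases hd with rfl | rfl <;> norm_num) hm (hP.muS_mem x hxΩ)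
    (hP.mucS_mem x hxΩ) (hP.lamS_mem x hxΩ) _

theorem exists_coupleComplianceOp (hd : d = 2 ∨ d = 3) (hm : 0 < m) (hΩ : MeasurableSet Ω)
    (hP : P.Admissible Ω m M) :
    ∃ A : L2 Ω (Mat (rotDim d) d) →ₗ[ℝ] L2 Ω (Mat (rotDim d) d),
      (∀ ω ω' : L2 Ω (Mat (rotDim d) d),
        pairing Ω (fun x => coupleCompliance d (P.muW x) (P.mucW x) (P.lamW x) (ω x)) ω'
          = inner ℝ (A ω) ω') ∧
      ∀ ω, 1 / (5 * M) * ‖ω‖ ^ 2 ≤ inner ℝ (A ω) ω := by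
  obtain ⟨-, -, -, hmu, hmuc, hlam⟩ := hP.measurable
  obtain ⟨A, hA, -⟩ := exists_pointwiseOp hΩ
    (fun x => coupleComplianceLin d (P.muW x) (P.mucW x) (P.lamW x)) (K := 3 / (2 * m))
    (fun x hx v => by
      rw [coupleComplianceLin_apply hd]
      exact norm_coupleCompliance_le hd hm (hP.muW_mem x hx).1 (hP.mucW_mem x hx).1
        (hP.lamW_mem x hx).1 v)
    (fun ω => by
      simp only [coupleComplianceLin_apply hd]
      exact aestronglyMeasurable_coupleCompliance hd hmu hmuc hlam (Lp.aestronglyMeasurable ω))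
  simp only [coupleComplianceLin_apply hd] at hA
  refine ⟨A, fun ω ω' => pairing_eq_inner_of_ae (hA ω) ω', fun ω => inner_ge_of_ae ?_⟩
  filter_upwards [hA ω, ae_restrict_mem hΩ] with x hx hxΩ
  rw [hx]
  exact inner_coupleCompliance_ge hd hm (hP.muW_mem x hxΩ)
    (hP.mucW_mem x hxΩ) (hP.lamW_mem x hxΩ) _

theorem exists_asymOp (hd : d = 2 ∨ d = 3) (hΩ : MeasurableSet Ω) :
    ∃ J : L2 Ω (Mat d d) →ₗ[ℝ] L2 Ω (Vec (rotDim d)),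
      (∀ (σ : L2 Ω (Mat d d)) (r : L2 Ω (Vec (rotDim d))),
        pairing Ω (fun x => asym d (σ x)) r = inner ℝ (J σ) r) ∧
      ∀ σ, ‖J σ‖ ≤ 2 * ‖σ‖ := by
  obtain ⟨J, hJ, hJn⟩ := exists_pointwiseOp hΩ (fun _ => asymLin hd) (K := 2)
    (fun _ _ v => norm_asym_le hd v)
    (fun σ => ((asymLin hd).continuous_of_finiteDimensional).comp_aestronglyMeasurable
      (Lp.aestronglyMeasurable σ))
  exact ⟨J, fun σ r => pairing_eq_inner_of_ae (hJ σ) r, hJn⟩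

/-- The bound `L` serves only to make multiplication by `ℓ` an operator on `L²`; its value is not
carried into the conclusion. -/
theorem exists_scaledDivLin {p : ℕ} (hΩ : IsOpen Ω) {l : Vec d → ℝ} (hl : ContinuousOn l Ω)
    (hl0 : ∀ x ∈ Ω, 0 ≤ l x) {L : ℝ} (hL : ∀ x ∈ Ω, l x ≤ L)
    (V : Submodule ℝ (L2 Ω (Mat p d)))
    (hex : ∀ ω ∈ V, ∃ g : L2 Ω (Vec p), IsWeakDiv Ω (scaled l ω) g) :
    ∃ D : V →ₗ[ℝ] L2 Ω (Vec p), ∀ ω : V, D ω = weakDiv Ω (scaled l (ω : L2 Ω (Mat p d))) := by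
  obtain ⟨T, hT, -⟩ := exists_pointwiseOp hΩ.measurableSet
    (fun x => l x • (LinearMap.id : Mat p d →ₗ[ℝ] Mat p d)) (K := L)
    (fun x hx v => by
      rw [LinearMap.smul_apply, LinearMap.id_apply, norm_smul, Real.norm_of_nonneg (hl0 x hx)]
      exact mul_le_mul_of_nonneg_right (hL x hx) (norm_nonneg _))
    (fun ω => (hl.aestronglyMeasurable hΩ.measurableSet).smul (Lp.aestronglyMeasurable ω))
  exact exists_weakDivLin hΩ V T (scaled l) hT hex

end Operators

/-! ### Near-maximizing stresses and the final assembly -/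

/-- Every elasticity-stable triplet admits a stress that nearly attains the inf-sup quotient. -/
theorem ElasticityStable.exists_stress {d : ℕ} {Ω : Set (Vec d)} {β : ℝ}
    {Sh : Submodule ℝ (L2 Ω (Mat d d))} {Uh : Submodule ℝ (L2 Ω (Vec d))}
    {Rh : Submodule ℝ (L2 Ω (Vec (rotDim d)))} (hβ : 0 < β)
    (h : ElasticityStable Ω β Sh Uh Rh) (y : Uh × Rh) (hy : y ≠ 0) :
    ∃ σ : Sh, 0 < stressNorm Ω (σ : L2 Ω (Mat d d)) ∧
      β / 2 * (stressNorm Ω (σ : L2 Ω (Mat d d)) * pairNorm y)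
        ≤ pairing Ω (weakDiv Ω (σ : L2 Ω (Mat d d))) (y.1 : L2 Ω (Vec d))
          + pairing Ω (fun x => asym d ((σ : L2 Ω (Mat d d)) x))
            (y.2 : L2 Ω (Vec (rotDim d))) := by
  have hne : ((y.1 : L2 Ω (Vec d)), (y.2 : L2 Ω (Vec (rotDim d)))) ≠ 0 := by
    intro h0
    refine hy (Prod.ext (Subtype.ext ?_) (Subtype.ext ?_))
    exacts [congrArg Prod.fst h0, congrArg Prod.snd h0]
  -- Passing from `β` to `β / 2` yields a stress without having to show that the supremum is
  -- attained.
  obtain ⟨σ, hσ⟩ := exists_lt_of_lt_ciSup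
    ((half_lt_self hβ).trans_le (h y.1 y.1.2 y.2 y.2.2 hne))
  rw [pairNorm_coe] at hσ
  have hs0 : 0 ≤ stressNorm Ω (σ : L2 Ω (Mat d d)) := Real.sqrt_nonneg _
  have hp0 : 0 ≤ pairNorm y := Real.sqrt_nonneg _
  have hpos : 0 < stressNorm Ω (σ : L2 Ω (Mat d d)) * pairNorm y := by
    -- A zero denominator would make the quotient `0`, which does not exceed `β / 2`.
    refine (mul_nonneg hs0 hp0).lt_of_ne fun h0 => ?_
    rw [← h0, div_zero] at hσ
    linarith
  exact ⟨σ, pos_of_mul_pos_left hpos hp0, ((lt_div_iff₀ hpos).1 hσ).le⟩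

theorem Material.Admissible.mono {d : ℕ} {P : Material d} {Ω : Set (Vec d)} {m M M' : ℝ}
    (h : P.Admissible Ω m M) (hM : M ≤ M') : P.Admissible Ω m M' where
  measurable := h.measurable
  muS_mem x hx := Set.Icc_subset_Icc_right hM (h.muS_mem x hx)
  mucS_mem x hx := Set.Icc_subset_Icc_right hM (h.mucS_mem x hx)
  lamS_mem x hx := Set.Icc_subset_Icc_right hM (h.lamS_mem x hx)
  muW_mem x hx := Set.Icc_subset_Icc_right hM (h.muW_mem x hx)
  mucW_mem x hx := Set.Icc_subset_Icc_right hM (h.mucW_mem x hx)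
  lamW_mem x hx := Set.Icc_subset_Icc_right hM (h.lamW_mem x hx)

end Cosserat

open Cosserat in
theorem mainTheorem7 (d : ℕ) (hd : d = 2 ∨ d = 3)
    (m M β : ℝ) (hm : 0 < m) (hβ : 0 < β) :
    ∃ C : ℝ, 0 < C ∧
      ∀ (Ω Γe Γn : Set (Cosserat.Vec d)),
        IsOpen Ω → Γe ∪ Γn = frontier Ω → Disjoint Γe Γn →
      ∀ (P : Cosserat.Material d), P.Admissible Ω m M →
      ∀ (Sh : Submodule ℝ (Cosserat.L2 Ω (Cosserat.Mat d d)))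
        (Uh : Submodule ℝ (Cosserat.L2 Ω (Cosserat.Vec d)))
        (Rh : Submodule ℝ (Cosserat.L2 Ω (Cosserat.Vec (Cosserat.rotDim d))))
        [FiniteDimensional ℝ Sh] [FiniteDimensional ℝ Uh] [FiniteDimensional ℝ Rh],
        (Sh : Set _) ⊆ Cosserat.stressSpace Ω Γe →
        (∀ σ ∈ Sh, Cosserat.weakDiv Ω σ ∈ Uh) →
        Cosserat.ElasticityStable Ω β Sh Uh Rh →
      ∀ (l : Cosserat.Vec d → ℝ),
        ContinuousOn l Ω → (∀ x ∈ Ω, 0 ≤ l x) → (∃ L : ℝ, ∀ x ∈ Ω, l x ≤ L) →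
      ∀ (Wh : Submodule ℝ (Cosserat.L2 Ω (Cosserat.Mat (Cosserat.rotDim d) d)))
        [FiniteDimensional ℝ Wh],
        (Wh : Set _) ⊆ Cosserat.coupleSpace Ω Γe l →
      ∀ (g : (Sh × Wh) →ₗ[ℝ] ℝ) (f : StrongDual ℝ (Cosserat.YSpace Ω)),
        ∃ z : (Sh × Wh) × (Uh × Rh),
          Cosserat.IsSolution Ω P l g f z ∧
          (∀ z' : (Sh × Wh) × (Uh × Rh), Cosserat.IsSolution Ω P l g f z' → z' = z) ∧
          Cosserat.normXh Ω l Rh (z.1.1 : Cosserat.L2 Ω (Cosserat.Mat d d))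
              (z.1.2 : Cosserat.L2 Ω (Cosserat.Mat (Cosserat.rotDim d) d))
            + ‖(WithLp.toLp 2 ((z.2.1 : Cosserat.L2 Ω (Cosserat.Vec d)),
                (z.2.2 : Cosserat.L2 Ω (Cosserat.Vec (Cosserat.rotDim d)))) :
                Cosserat.YSpace Ω)‖
            ≤ C * (Cosserat.dualNormXh Ω l Rh g + ‖f‖) := by
  -- The constant is fixed before `Ω` and `M` may be less than `m`, even negative; enlarging `M` to
  -- `max M m` keeps the coercivity constant positive.
  have hM : 0 < max M m := hm.trans_le (le_max_right _ _)
  have hc : 0 < 1 / (5 * max M m) := by positivity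
  have hK : 0 ≤ 3 / (2 * m) := by positivity
  refine ⟨saddleConst (1 / (5 * max M m)) (3 / (2 * m)) β, saddleConst_pos hc hK hβ, ?_⟩
  intro Ω Γe Γn hΩ _ _ P hP Sh Uh Rh _ _ _ hSh hdiv hstab l hl hl0 ⟨L, hL⟩ Wh _ hWh g f
  replace hP := hP.mono (le_max_left M m)
  obtain ⟨A₁, hA₁, hA₁n, hA₁c⟩ := exists_complianceOp hd hm hΩ.measurableSet hP
  obtain ⟨A₂, hA₂, hA₂c⟩ := exists_coupleComplianceOp hd hm hΩ.measurableSet hP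
  obtain ⟨J₀, hJ₀, hJ₀n⟩ := exists_asymOp hd hΩ.measurableSet
  obtain ⟨D₀, hD₀⟩ := exists_weakDivLin hΩ Sh LinearMap.id (fun σ => σ)
    (fun _ => Filter.EventuallyEq.rfl) fun σ hσ => (hSh hσ).imp fun _ h => h.1
  obtain ⟨E₀, hE₀⟩ := exists_scaledDivLin hΩ hl hl0 hL Wh
    fun ω hω => (hWh hω).imp fun _ h => h.1
  -- The divergence already lies in `U_h`, whereas `J` and `E` have to be projected to `R_h`.
  -- Pairings with elements of `R_h` do not notice the projection, and `‖E ω‖` becomes exactly the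
  -- last term of the discrete norm.
  let D : Sh →ₗ[ℝ] Uh := D₀.codRestrict Uh fun σ => by rw [hD₀]; exact hdiv σ σ.2
  let J : Sh →ₗ[ℝ] Rh := Rh.orthogonalProjectionOnto.toLinearMap ∘ₗ J₀ ∘ₗ Sh.subtype
  let E : Wh →ₗ[ℝ] Rh := Rh.orthogonalProjectionOnto.toLinearMap ∘ₗ E₀
  have hD : ∀ σ : Sh, (D σ : L2 Ω (Vec d)) = weakDiv Ω (σ : L2 Ω (Mat d d)) := hD₀
  have hDn : ∀ σ : Sh, ‖D σ‖ = ‖weakDiv Ω (σ : L2 Ω (Mat d d))‖ := fun σ => by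
    rw [← hD, Submodule.coe_norm]
  have hDi : ∀ (σ : Sh) (u : Uh), inner ℝ (D σ) u
      = pairing Ω (weakDiv Ω (σ : L2 Ω (Mat d d))) (u : L2 Ω (Vec d)) := fun σ u => by
    rw [pairing_eq_inner, ← hD, Submodule.coe_inner]
  have hJi : ∀ (σ : Sh) (r : Rh), inner ℝ (J σ) r
      = pairing Ω (fun x => asym d ((σ : L2 Ω (Mat d d)) x)) (r : L2 Ω (Vec (rotDim d))) :=
    fun σ r => by
      rw [hJ₀]
      exact Submodule.inner_orthogonalProjectionOnto_eq_of_mem_right r (J₀ σ)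
  have hEi : ∀ (ω : Wh) (r : Rh), inner ℝ (E ω) r
      = pairing Ω (weakDiv Ω (scaled l (ω : L2 Ω (Mat (rotDim d) d))))
        (r : L2 Ω (Vec (rotDim d))) := fun ω r => by
    rw [pairing_eq_inner, ← hE₀]
    exact Submodule.inner_orthogonalProjectionOnto_eq_of_mem_right r (E₀ ω)
  have hEn : ∀ ω : Wh, ‖E ω‖
      = ‖Rh.starProjection (weakDiv Ω (scaled l (ω : L2 Ω (Mat (rotDim d) d))))‖ := fun ω => by
    rw [← hE₀]
    rfl
  have hX : ∀ x : Sh × Wh, normXh Ω l Rh (x.1 : L2 Ω (Mat d d))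
      (x.2 : L2 Ω (Mat (rotDim d) d)) = graphNorm D E x := fun x => by
    rw [normXh, graphNorm, hDn, hEn, Submodule.coe_norm, Submodule.coe_norm]
  have hG : dualNormXh Ω l Rh g = ⨆ x, g x / graphNorm D E x := by
    simp only [dualNormXh, hX]
  have hop : ∀ z : (Sh × Wh) × (Uh × Rh), IsSolution Ω P l g f z ↔
      ∀ y, saddleOp (energyForm A₁ A₂ Sh Wh) (saddleB D J E) z y
        = g y.1 + restrictPair Uh Rh f y.2 := fun z => by
    simp only [IsSolution, Prod.forall, saddleOp_apply, saddleB_apply, energyForm_apply,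
      restrictPair_apply, formA, formB, hA₁, hA₂, hDi, hJi, hEi]
  obtain ⟨z, hz, huniq, hbound⟩ := saddle_wellPosed (energyForm A₁ A₂ Sh Wh) D J E hc hK hβ
    (fun x => by
      rw [energyForm_apply, mul_add]
      exact add_le_add (hA₁c _) (hA₂c _))
    (fun x σ => by
      rw [energyForm_apply, Submodule.coe_zero, inner_zero_right, add_zero]
      exact (real_inner_le_norm _ _).trans
        (mul_le_mul_of_nonneg_right (hA₁n _) (norm_nonneg _)))
    (fun σ => (Submodule.norm_orthogonalProjectionOnto_apply_le Rh _).trans (hJ₀n _))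
    (fun y hy => by
      obtain ⟨σ, hσ, hle⟩ := hstab.exists_stress hβ y hy
      have hs : graphNorm D E (σ, 0) = stressNorm Ω (σ : L2 Ω (Mat d d)) := by
        rw [graphNorm_fst, hDn, stressNorm, Submodule.coe_norm]
      exact ⟨σ, by rwa [hs], by rwa [hs, hDi, hJi]⟩)
    (iSup_div_nonneg (norm_le_graphNorm D E) g) (norm_nonneg f) g (restrictPair Uh Rh f)
    (abs_le_iSup_div_mul (norm_le_graphNorm D E) (graphNorm_neg D E) g)
    (fun y => by
      rw [restrictPair_apply, ← pairNorm_coe]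
      exact f.le_opNorm _)
  refine ⟨z, (hop z).2 hz, fun z' hz' => huniq z' ((hop z').1 hz'), ?_⟩
  rw [hX, hG, pairNorm_coe]
  exact hbound
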